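/- Let $G=(V,E)$ be a finite graph (parallel edges and loops are allowed), let $R$ be a finite multiset of vertices of $G$, and let $\mathcal M$ be a matroid on $R$ of rank $k$ with rank function $r_{\mathcal M}$. For $F\subseteq E$ let $V(F)$ be the set of vertices incident to an edge of $F$; for $v\in V$ let $R_v$ be the sub-multiset of the members of $R$ equal to $v$, and for $F\subseteq E$ let $R_F$ be the sub-multiset of the members of $R$ lying in $V(F)$. Consider the conditions (C1) $R_v$ is independent in $\mathcal M$ for each $v\in V$; (C2) $|F|+|R_F|\le k|V(F)|-k+r_{\mathcal M}(R_F)$ for each non-empty $F\subseteq E$; (C3) $|E|+|R|=k|V|$. **Theorem.** There is an algorithm (one fixed program of a unit-cost random access machine whose arithmetic is addition, subtraction and comparison) that, given $|V|$, $|E|$, $|R|$, the list of the two ends of each edge, the list of the positions of the members of $R$, and access to $\mathcal M$ by an independence oracle only, always halts and decides correctly whether (C1), (C2) and (C3) all hold. If an oracle call takes time $Q\ge 1$ and $k\ge 1$, then its running time is $$O\bigl(k^4|V|^2+k^2|V||R|^2Q\bigr),$$ with an absolute implied constant. If $k=0$, its running time is $O(Q)$. -/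

import Mathlib

open scoped Graph

noncomputable section

/-! ### The three counting conditions

A graph with roots is a (multi)graph `G` on vertex type `V` with edge type `E`, together with a
family `root : R → V`; the index type `R` is the multiset of roots, and the matroid lives on `R`. -/

namespace RootedGraph

variable {V E R : Type*}

/-- `V(F)`, the set of vertices incident to some edge of `F`. -/
def span (G : Graph V E) (F : Set E) : Set V := {v | ∃ e ∈ F, G.Inc e v}

/-- The sub-multiset of the roots that are located at a vertex of `X`. With `X = {v}` this is
`R_v`, with `X = V(F)` it is `R_F`. -/
def rootsIn (root : R → V) (X : Set V) : Set R := {i | root i ∈ X}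

/-- The rank of the matroid `M` (used for matroids on finite sets only). -/
def rank (M : Matroid R) : ℕ := M.eRank.toNat

/-- The rank function of the matroid `M` (used for matroids on finite sets only). -/
def rk (M : Matroid R) (X : Set R) : ℕ := (M.eRk X).toNat

/-- (C1): the roots at each vertex are independent. -/
def C1 (G : Graph V E) (root : R → V) (M : Matroid R) : Prop :=
  ∀ v ∈ V(G), M.Indep (rootsIn root {v})

/-- (C2): `|F| + |R_F| ≤ k|V(F)| - k + r(R_F)` for each non-empty set `F` of edges. -/
def C2 (G : Graph V E) (root : R → V) (M : Matroid R) : Prop :=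
  ∀ F : Set E, F ⊆ E(G) → F.Nonempty →
    (F.ncard : ℤ) + ((rootsIn root (span G F)).ncard : ℤ) ≤
      (rank M : ℤ) * ((span G F).ncard : ℤ) - (rank M : ℤ) + (rk M (rootsIn root (span G F)) : ℤ)

/-- (C3): `|E| + |R| = k|V|`. -/
def C3 (G : Graph V E) (M : Matroid R) : Prop :=
  E(G).ncard + Nat.card R = rank M * V(G).ncard

/-- All three conditions. -/
def Conditions (G : Graph V E) (root : R → V) (M : Matroid R) : Prop :=
  C1 G root M ∧ C2 G root M ∧ C3 G M

end RootedGraph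

/-! ### Random access machines with an oracle

Programs are finite structured programs over finitely many registers and finitely many arrays
(those whose names occur in the program), all holding natural numbers. Every arithmetic operation,
comparison, register access, array access and branching costs one time unit; the only arithmetic is
addition, truncated subtraction and comparison. An oracle call costs `Q` time units. -/

namespace OracleRAM

/-- The memory: registers and arrays, each addressed by a name; `arr a i` is `a[i]`. -/
structure State where
  reg : ℕ → ℕ
  arr : ℕ → ℕ → ℕ

/-- Side-effect free expressions. -/
inductive Expr where
  | const (c : ℕ)
  | reg (x : ℕ)
  | get (a : ℕ) (i : Expr)
  | add (e f : Expr)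
  | sub (e f : Expr)
  | lt (e f : Expr)
  | eq (e f : Expr)

/-- The value of an expression. -/
def Expr.eval (s : State) : Expr → ℕ
  | .const c => c
  | .reg x => s.reg x
  | .get a i => s.arr a (i.eval s)
  | .add e f => e.eval s + f.eval s
  | .sub e f => e.eval s - f.eval s
  | .lt e f => if e.eval s < f.eval s then 1 else 0
  | .eq e f => if e.eval s = f.eval s then 1 else 0

/-- The time for evaluating an expression: one unit for each node. -/
def Expr.cost : Expr → ℕ
  | .const _ => 1
  | .reg _ => 1
  | .get _ i => i.cost + 1
  | .add e f => e.cost + f.cost + 1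
  | .sub e f => e.cost + f.cost + 1
  | .lt e f => e.cost + f.cost + 1
  | .eq e f => e.cost + f.cost + 1

/-- Programs. A condition holds if its value is not zero. -/
inductive Prog where
  | skip
  | assign (x : ℕ) (e : Expr)
  | store (a : ℕ) (i e : Expr)
  | query (x a : ℕ)
  | seq (p q : Prog)
  | ite (b : Expr) (p q : Prog)
  | while (b : Expr) (p : Prog)

/-- `x := v` -/
def State.setReg (s : State) (x v : ℕ) : State :=
  { s with reg := Function.update s.reg x v }

/-- `a[i] := v` -/
def State.setArr (s : State) (a i v : ℕ) : State :=
  { s with arr := Function.update s.arr a (Function.update (s.arr a) i v) }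

open Classical in
/-- `Exec O Q p s s' T`: started in state `s`, the program `p` halts in state `s'` after `T` time
units, where `O` is the oracle, which answers a yes/no question about the content of one array, and
`Q` is the time of an oracle call. -/
inductive Exec (O : (ℕ → ℕ) → Prop) (Q : ℕ) : Prog → State → State → ℕ → Prop
  | skip (s : State) : Exec O Q .skip s s 1
  | assign (s : State) (x : ℕ) (e : Expr) :
      Exec O Q (.assign x e) s (s.setReg x (e.eval s)) (e.cost + 1)
  | store (s : State) (a : ℕ) (i e : Expr) :
      Exec O Q (.store a i e) s (s.setArr a (i.eval s) (e.eval s)) (i.cost + e.cost + 1)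
  | query (s : State) (x a : ℕ) :
      Exec O Q (.query x a) s (s.setReg x (if O (s.arr a) then 1 else 0)) Q
  | seq {p q : Prog} {s s' s'' : State} {T T' : ℕ} :
      Exec O Q p s s' T → Exec O Q q s' s'' T' → Exec O Q (.seq p q) s s'' (T + T')
  | ite_true {b : Expr} {p q : Prog} {s s' : State} {T : ℕ} :
      b.eval s ≠ 0 → Exec O Q p s s' T → Exec O Q (.ite b p q) s s' (b.cost + 1 + T)
  | ite_false {b : Expr} {p q : Prog} {s s' : State} {T : ℕ} :
      b.eval s = 0 → Exec O Q q s s' T → Exec O Q (.ite b p q) s s' (b.cost + 1 + T)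
  | while_true {b : Expr} {p : Prog} {s s' s'' : State} {T T' : ℕ} :
      b.eval s ≠ 0 → Exec O Q p s s' T → Exec O Q (.while b p) s' s'' T' →
      Exec O Q (.while b p) s s'' (b.cost + 1 + T + T')
  | while_false {b : Expr} {p : Prog} {s : State} :
      b.eval s = 0 → Exec O Q (.while b p) s s (b.cost + 1)

/-- The independence oracle of a matroid on `{0, …, t - 1}`; the queried set is given by its
characteristic vector. -/
def indepOracle {t : ℕ} (M : Matroid (Fin t)) : (ℕ → ℕ) → Prop :=
  fun f => M.Indep {i : Fin t | f i ≠ 0}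

/-- The array with the entries `f 0, …, f (l - 1)`, followed by zeros. -/
def arrayOf {l n : ℕ} (f : Fin l → Fin n) : ℕ → ℕ :=
  fun i => if h : i < l then (f ⟨i, h⟩ : ℕ) else 0

/-- The initial memory. Registers `0, 1, 2` hold `|V|, |E|, |R|`; arrays `0` and `1` hold the two
ends of each edge, array `2` the position of each root; everything else is zero. The matroid
(and in particular its rank) is accessible through the oracle only. -/
def input {n m t : ℕ} (fst snd : Fin m → Fin n) (root : Fin t → Fin n) : State where
  reg := fun x => if x = 0 then n else if x = 1 then m else if x = 2 then t else 0
  arr := fun a => if a = 0 then arrayOf fst else if a = 1 then arrayOf snd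
    else if a = 2 then arrayOf root else fun _ => 0

end OracleRAM

end

noncomputable section

namespace OracleRAM

/-! Split each edge into two half-edges placed at its ends, and call the roots and half-edges items.
In `itemMatroid` the two halves of an edge are parallel, so a base `B` consists of a base of `M` and
one half of each edge. The `load` of a vertex counts the items outside `B` located there: every edge
charges one of its ends, as in an orientation, and every root outside the base charges its position.
The guiding fact is that (C1) and (C2) hold together exactly if each vertex `v` admits a base with
load 0 at `v` and load at most `k` everywhere.

That such bases suffice is a count (`C1_and_C2_of_isBase`): `|F| + |R_F|` is at most the total load
of `V(F)` plus the rank of `R_F`, and freeing one vertex of `V(F)` saves `k`. All roots at a freed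
vertex lie in the base, which gives (C1).

For the converse, an exchange of `y ∈ B` for `x ∉ B` (`Matroid.Arc`) moves one unit of load from the
position of `x` to that of `y`. Starting at a vertex `v₀` of positive load, search the digraph of
all these moves. If another vertex of load below `k` is reached, the exchanges along a breadth-first
path carry one unit there. They can be performed one after the other, from the far end, because such
a path has no shortcuts (`SearchTree.augPath`, `AugPath.exchange`). If none is reached, the reached
set is closed under exchanges, so its load counts only edges inside it and roots in excess of their
rank (`sum_load_le`); this load is too large for (C1) and (C2) (`not_C1_and_C2_of_closed`).

The program checks (C3), then relieves each vertex in turn to load 0, in two passes. Since only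
vertices below `k` gain load, all loads are at most `k` after the first pass, and the second pass
produces the certificates (`runs_mainStep`). By (C3), `|E| + |R| = k|V|`, so `O(k|V|)` steps of time
`O(|R|^2 Q + |E| + |V|)` suffice (`decideCounts_time_le`). Correctness and time are verified
together in a Hoare logic. -/

theorem State.setReg_reg (s : State) (x v y : ℕ) :
    (s.setReg x v).reg y = if y = x then v else s.reg y :=
  Function.update_apply _ _ _ _

theorem State.setReg_arr (s : State) (x v : ℕ) : (s.setReg x v).arr = s.arr := rfl

theorem State.setArr_reg (s : State) (a i v : ℕ) : (s.setArr a i v).reg = s.reg := rfl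

theorem State.setArr_arr (s : State) (a i v b : ℕ) :
    (s.setArr a i v).arr b = if b = a then Function.update (s.arr a) i v else s.arr b :=
  Function.update_apply _ _ _ _

attribute [simp] State.setReg_reg State.setReg_arr State.setArr_reg State.setArr_arr

/-! ### A Hoare logic with time bounds -/

/-- The registers that a program may write to. -/
def Prog.regs : Prog → List ℕ
  | .skip => []
  | .assign x _ => [x]
  | .store _ _ _ => []
  | .query x _ => [x]
  | .seq p q => p.regs ++ q.regs
  | .ite _ p q => p.regs ++ q.regs
  | .while _ p => p.regs

/-- The arrays that a program may write to. -/
def Prog.arrs : Prog → List ℕ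
  | .skip => []
  | .assign _ _ => []
  | .store a _ _ => [a]
  | .query _ _ => []
  | .seq p q => p.arrs ++ q.arrs
  | .ite _ p q => p.arrs ++ q.arrs
  | .while _ p => p.arrs

/-- The state `s'` agrees with `s` wherever `p` does not write. -/
def Frame (p : Prog) (s s' : State) : Prop :=
  (∀ x, x ∉ p.regs → s'.reg x = s.reg x) ∧ ∀ a, a ∉ p.arrs → s'.arr a = s.arr a

theorem Frame.refl (p : Prog) (s : State) : Frame p s s := ⟨fun _ _ => rfl, fun _ _ => rfl⟩

theorem Frame.trans {p : Prog} {s s' s'' : State} (h : Frame p s s') (h' : Frame p s' s'') :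
    Frame p s s'' :=
  ⟨fun x hx => (h'.1 x hx).trans (h.1 x hx), fun a ha => (h'.2 a ha).trans (h.2 a ha)⟩

theorem Frame.of_subset {p q : Prog} {s s' : State} (h : Frame p s s')
    (hr : ∀ x ∈ p.regs, x ∈ q.regs) (ha : ∀ a ∈ p.arrs, a ∈ q.arrs) : Frame q s s' :=
  ⟨fun x hx => h.1 x fun h => hx (hr x h), fun a hx => h.2 a fun h => hx (ha a h)⟩

theorem Frame.setReg {p : Prog} (s : State) {x : ℕ} (v : ℕ) (hx : x ∈ p.regs) :
    Frame p s (s.setReg x v) :=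
  ⟨fun y hy => Function.update_of_ne (by rintro rfl; exact hy hx) _ _, fun _ _ => rfl⟩

theorem Frame.seq_left {p q : Prog} {s s' : State} (h : Frame p s s') : Frame (.seq p q) s s' :=
  h.of_subset (fun _ h => List.mem_append_left _ h) (fun _ h => List.mem_append_left _ h)

theorem Frame.seq_right {p q : Prog} {s s' : State} (h : Frame q s s') : Frame (.seq p q) s s' :=
  h.of_subset (fun _ h => List.mem_append_right _ h) (fun _ h => List.mem_append_right _ h)

variable {O : (ℕ → ℕ) → Prop} {Q : ℕ}

theorem Exec.frame {p : Prog} {s s' : State} {T : ℕ} (h : Exec O Q p s s' T) : Frame p s s' := by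
  induction h with
  | skip s => exact Frame.refl _ _
  | assign s x e => exact Frame.setReg _ _ (List.mem_singleton_self x)
  | store s a i e =>
    refine ⟨fun _ _ => rfl, fun b hb => Function.update_of_ne (fun h => hb ?_) _ _⟩
    simp [Prog.arrs, h]
  | query s x a => exact Frame.setReg _ _ (List.mem_singleton_self x)
  | seq _ _ ih ih' => exact ih.seq_left.trans ih'.seq_right
  | ite_true _ _ ih =>
    exact ih.of_subset (fun _ h => List.mem_append_left _ h) (fun _ h => List.mem_append_left _ h)
  | ite_false _ _ ih =>
    exact ih.of_subset (fun _ h => List.mem_append_right _ h) (fun _ h => List.mem_append_right _ h)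
  | while_true _ _ _ ih ih' => exact Frame.trans (p := .while _ _) ih ih'
  | while_false _ => exact Frame.refl _ _

/-- Started in `s`, the program `p` halts within `T` time units in a state satisfying `post`. -/
def Runs (O : (ℕ → ℕ) → Prop) (Q : ℕ) (p : Prog) (s : State) (T : ℕ) (post : State → Prop) : Prop :=
  ∃ s' T', Exec O Q p s s' T' ∧ T' ≤ T ∧ post s'

/-- The frame is handed to the consequence, so a postcondition need not mention memory that `p`
leaves alone. -/
theorem Runs.mono {p : Prog} {s : State} {T T' : ℕ} {post post' : State → Prop}
    (h : Runs O Q p s T post) (hT : T ≤ T') (hp : ∀ s', Frame p s s' → post s' → post' s') :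
    Runs O Q p s T' post' := by
  obtain ⟨s', T₀, he, hT₀, hs⟩ := h
  exact ⟨s', T₀, he, hT₀.trans hT, hp s' he.frame hs⟩

theorem Runs.seq {p q : Prog} {s : State} {T T' : ℕ} {mid post : State → Prop}
    (h : Runs O Q p s T mid) (h' : ∀ s', Frame p s s' → mid s' → Runs O Q q s' T' post) :
    Runs O Q (.seq p q) s (T + T') post := by
  obtain ⟨s', T₀, he, hT₀, hs⟩ := h
  obtain ⟨s'', T₁, he', hT₁, hs'⟩ := h' s' he.frame hs
  exact ⟨s'', T₀ + T₁, .seq he he', Nat.add_le_add hT₀ hT₁, hs'⟩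

theorem Runs.ite {b : Expr} {p q : Prog} {s : State} {T : ℕ} {post : State → Prop}
    (h : b.eval s ≠ 0 → Runs O Q p s T post) (h' : b.eval s = 0 → Runs O Q q s T post) :
    Runs O Q (.ite b p q) s (b.cost + 1 + T) post := by
  by_cases hb : b.eval s = 0
  · obtain ⟨s', T₀, he, hT₀, hs⟩ := h' hb
    exact ⟨s', _, .ite_false hb he, Nat.add_le_add_left hT₀ _, hs⟩
  · obtain ⟨s', T₀, he, hT₀, hs⟩ := h hb
    exact ⟨s', _, .ite_true hb he, Nat.add_le_add_left hT₀ _, hs⟩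

/-- The invariant carries a time budget `c` out of which each round pays for itself. This amortised
form fits loops governed by a potential, and it yields termination as well. -/
theorem Runs.while {b : Expr} {p : Prog} {I : ℕ → State → Prop}
    (c : ℕ) (s : State) (h0 : I c s)
    (hstep : ∀ c s', I c s' → Frame p s s' → b.eval s' ≠ 0 →
      ∃ T, Runs O Q p s' T fun s'' => ∃ c', I c' s'' ∧ b.cost + 1 + T + c' ≤ c) :
    Runs O Q (.while b p) s (c + b.cost + 1) fun s' => (∃ c', I c' s') ∧ b.eval s' = 0 := by
  suffices H : ∀ c s', I c s' → Frame p s s' →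
      Runs O Q (.while b p) s' (c + b.cost + 1) fun s' => (∃ c', I c' s') ∧ b.eval s' = 0 from
    H c s h0 (Frame.refl _ _)
  intro c
  induction c using Nat.strong_induction_on with
  | _ c ih =>
    intro s' hI hf
    by_cases hb : b.eval s' = 0
    · exact ⟨s', _, .while_false hb, by omega, ⟨c, hI⟩, hb⟩
    · obtain ⟨T, s'', T₁, he, hT₁, c', hI', hc⟩ := hstep c s' hI hf hb
      obtain ⟨s₂, T₂, he₂, hT₂, h₂⟩ := ih c' (by omega) s'' hI' (hf.trans he.frame)
      exact ⟨s₂, _, .while_true hb he he₂, by omega, h₂⟩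

/-- `for x := 0, …, e - 1 do p` -/
def forLoop (x : ℕ) (e : Expr) (p : Prog) : Prog :=
  .seq (.assign x (.const 0))
    (.while (.lt (.reg x) e) (.seq p (.assign x (.add (.reg x) (.const 1)))))

/-- A round pays `T` for the body, `e.cost + 3` for the test and 4 for the increment; the trailing
`e.cost + 5` is the initial assignment and the failing test. -/
theorem Runs.forLoop {x : ℕ} {e : Expr} {p : Prog} {s : State} (N T : ℕ) (I : ℕ → State → Prop)
    (hx : x ∉ p.regs) (he : ∀ s', Frame (forLoop x e p) s s' → e.eval s' = N)
    (h0 : I 0 (s.setReg x 0))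
    (hstep : ∀ j s', j < N → I j s' → s'.reg x = j → Frame (forLoop x e p) s s' →
      Runs O Q p s' T fun s'' => I (j + 1) (s''.setReg x (j + 1))) :
    Runs O Q (forLoop x e p) s (N * (T + e.cost + 7) + e.cost + 5)
      fun s' => I N s' ∧ s'.reg x = N := by
  have hlen : N * (T + e.cost + 7) + e.cost + 5 =
    2 + (N * (T + e.cost + 7) + (Expr.lt (.reg x) e).cost + 1) := by
    simp only [Expr.cost]; omega
  rw [hlen]
  refine Runs.seq (mid := fun s' => s' = s.setReg x 0)
    ⟨_, _, Exec.assign _ _ _, le_rfl, rfl⟩ ?_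
  rintro s' - rfl
  have hxm : x ∈ (OracleRAM.forLoop x e p).regs := by simp [OracleRAM.forLoop, Prog.regs]
  refine Runs.mono (Runs.while (I := fun c s' => ∃ j, j ≤ N ∧ s'.reg x = j ∧ I j s' ∧
    c = (N - j) * (T + e.cost + 7)) _ _ ⟨0, by omega, ?_, h0, rfl⟩ ?_) le_rfl ?_
  · simp [State.setReg]
  · rintro c s' ⟨j, hj, hxj, hI, rfl⟩ hf hb
    have hf' : Frame (OracleRAM.forLoop x e p) s s' :=
      (Frame.setReg s 0 hxm).trans (hf.of_subset
        (fun _ h => List.mem_append_right _ h) (fun _ h => List.mem_append_right _ h))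
    have hjN : j < N := by
      by_contra h
      simp [Expr.eval, he s' hf', hxj, h] at hb
    refine ⟨T + 4, ?_⟩
    refine Runs.seq (hstep j s' hjN hI hxj hf') ?_
    intro s'' hf'' hI''
    have : s''.reg x = j := (hf''.1 x hx).trans hxj
    refine ⟨_, _, Exec.assign _ _ _, le_rfl, (N - (j + 1)) * (T + e.cost + 7),
      ⟨j + 1, hjN, ?_, ?_, rfl⟩, ?_⟩
    · simp [State.setReg, Expr.eval, this]
    · simpa [Expr.eval, this] using hI''
    · have : N - j = N - (j + 1) + 1 := by omega
      rw [this, Nat.add_mul]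
      simp only [Expr.cost]
      omega
  · rintro s' hf ⟨⟨c, j, hj, hxj, hI, -⟩, hb⟩
    have hf' : Frame (OracleRAM.forLoop x e p) s s' :=
      (Frame.setReg s 0 hxm).trans (hf.of_subset
        (fun y h => by simpa [OracleRAM.forLoop, Prog.regs] using Or.inr h)
        (fun y h => by simpa [OracleRAM.forLoop, Prog.arrs] using h))
    have hjN : j = N := by
      by_contra h
      have : j < N := by omega
      simp [Expr.eval, he s' hf', hxj, this] at hb
    subst hjN
    exact ⟨hI, hxj⟩

/-! ### Symbolic execution of loop-free programs -/

/-- Programs without loops. -/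
def Prog.LoopFree : Prog → Prop
  | .seq p q => p.LoopFree ∧ q.LoopFree
  | .ite _ p q => p.LoopFree ∧ q.LoopFree
  | .while _ _ => False
  | _ => True

open Classical in
/-- The final state of a loop-free program. -/
def Prog.run (O : (ℕ → ℕ) → Prop) : Prog → State → State
  | .assign x e, s => s.setReg x (e.eval s)
  | .store a i e, s => s.setArr a (i.eval s) (e.eval s)
  | .query x a, s => s.setReg x (if O (s.arr a) then 1 else 0)
  | .seq p q, s => q.run O (p.run O s)
  | .ite b p q, s => if b.eval s ≠ 0 then p.run O s else q.run O s
  | _, s => s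

/-- A bound for the running time of a loop-free program. -/
def Prog.timeBound (Q : ℕ) : Prog → ℕ
  | .skip => 1
  | .assign _ e => e.cost + 1
  | .store _ i e => i.cost + e.cost + 1
  | .query _ _ => Q
  | .seq p q => p.timeBound Q + q.timeBound Q
  | .ite b p q => b.cost + 1 + (p.timeBound Q + q.timeBound Q)
  | .while _ _ => 0

theorem Runs.of_loopFree (p : Prog) (s : State) (hp : p.LoopFree) :
    Runs O Q p s (p.timeBound Q) fun s' => s' = p.run O s := by
  induction p generalizing s with
  | skip => exact ⟨_, _, .skip s, le_rfl, rfl⟩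
  | assign x e => exact ⟨_, _, .assign s x e, le_rfl, rfl⟩
  | store a i e => exact ⟨_, _, .store s a i e, le_rfl, rfl⟩
  | query x a => exact ⟨_, _, .query s x a, le_rfl, rfl⟩
  | seq p q ihp ihq =>
    refine (ihp s hp.1).seq ?_
    rintro s' - rfl
    exact ihq _ hp.2
  | ite b p q ihp ihq =>
    refine Runs.ite (fun hb => ?_) (fun hb => ?_)
    · exact (ihp s hp.1).mono (by omega) (by rintro s' - rfl; simp [Prog.run, hb])
    · exact (ihq s hp.2).mono (by omega) (by rintro s' - rfl; simp [Prog.run, hb])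
  | _ b p => exact hp.elim

/-- For loop-free code the final state is a term, so a correctness claim becomes a simplification of
`p.run O s`. -/
theorem Runs.straight {p : Prog} {s : State} {T : ℕ} {post : State → Prop} (hp : p.LoopFree)
    (hT : p.timeBound Q ≤ T) (h : post (p.run O s)) : Runs O Q p s T post :=
  (Runs.of_loopFree p s hp).mono hT (by rintro s' - rfl; exact h)

attribute [simp] Prog.run Prog.timeBound Prog.LoopFree Prog.regs Prog.arrs Expr.eval Expr.cost

end OracleRAM

/-! ### Exchanges at a base of a matroid -/

namespace Matroid

variable {α : Type*} {N : Matroid α} {B : Set α} {x y x' y' : α}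

/-- In the base `B`, the element `y` may be exchanged for `x`. -/
def Arc (N : Matroid α) (B : Set α) (x y : α) : Prop :=
  x ∈ N.E ∧ x ∉ B ∧ y ∈ B ∧ N.Indep (insert x (B \ {y}))

theorem Arc.isBase (hB : N.IsBase B) (h : N.Arc B x y) : N.IsBase (insert x (B \ {y})) :=
  hB.exchange_isBase_of_indep h.2.1 h.2.2.2

/-- Exchanging `y'` for `x'` does not affect the exchanges for an element `x` whose fundamental
circuit does not contain `y'`. -/
theorem Arc.arc_exchange_iff (hB : N.IsBase B) (h : N.Arc B x' y') (hx : x ∈ N.E) (hxB : x ∉ B)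
    (hne : ¬ N.Arc B x y') (hxx' : x ≠ x') (hyy' : y ≠ y') (hyx' : y ≠ x') :
    N.Arc (insert x' (B \ {y'})) x y ↔ N.Arc B x y := by
  have hB' := h.isBase hB
  have hxB' : x ∉ insert x' (B \ {y'}) := by simp [hxx', hxB]
  have hxc : x ∈ N.closure B := by rwa [hB.closure_eq]
  have hxc' : x ∈ N.closure (insert x' (B \ {y'})) := by rwa [hB'.closure_eq]
  have key : ∀ {A : Set α} {z : α}, N.IsBase A → x ∈ N.closure A → x ∉ A → z ∈ A →
      (N.Arc A x z ↔ z ∈ N.fundCircuit x A) := by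
    intro A z hA hxcA hxA hz
    rw [hA.indep.mem_fundCircuit_iff hxcA hxA,
      ← Set.insert_sdiff_singleton_comm (by rintro rfl; exact hxA hz)]
    simp [Arc, hx, hxA, hz]
  have hy'C : y' ∉ N.fundCircuit x B := by rwa [← key hB hxc hxB h.2.2.1]
  -- The circuit of `x` avoids `y'`, so it survives in the new base together with `x`; by uniqueness
  -- it is the fundamental circuit there too.
  have hC : N.fundCircuit x B = N.fundCircuit x (insert x' (B \ {y'})) := by
    refine (hB.indep.fundCircuit_isCircuit hxc hxB).eq_fundCircuit_of_subset hB'.indep ?_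
    intro z hz
    have := N.fundCircuit_subset_insert x B hz
    simp only [Set.mem_insert_iff, Set.mem_sdiff, Set.mem_singleton_iff] at this ⊢
    rcases this with h | h
    · exact Or.inl h
    · exact Or.inr (Or.inr ⟨h, by rintro rfl; exact hy'C hz⟩)
  by_cases hy : y ∈ B
  · rw [key hB hxc hxB hy, key hB' hxc' hxB' (by simp [hy, hyy']), hC]
  · simp [Arc, hy, hyx']

end Matroid

namespace RootedGraph

/-! ### Items: roots and half-edges -/

/-- Items are the roots `0, …, t - 1` and two half-edges `t + e` and `t + m + e` of each edge `e`. -/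
def itemProj (t m : ℕ) (i : ℕ) : ℕ ⊕ ℕ :=
  if i < t then .inl i else if i < t + m then .inr (i - t) else .inr (i - t - m)

/-- The matroid on the items: `M` on the roots, and at most one half of each edge. -/
def itemMatroid {t : ℕ} (M : Matroid (Fin t)) (m : ℕ) : Matroid ℕ :=
  ((M.mapEmbedding Fin.valEmbedding).sum (Matroid.freeOn Set.univ)).comapOn
    (Set.Iio (t + m + m)) (itemProj t m)

variable {n m t : ℕ} {M : Matroid (Fin t)}

/-- Independence in a pullback means independence of the image and injectivity of `itemProj`; the
latter fails exactly when both halves of an edge are present. -/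
theorem itemMatroid_indep_iff {I : Set ℕ} : (itemMatroid M m).Indep I ↔
    M.Indep {i : Fin t | (i : ℕ) ∈ I} ∧ (∀ e < m, ¬ (t + e ∈ I ∧ t + m + e ∈ I)) ∧
      ∀ i ∈ I, i < t + m + m := by
  rw [itemMatroid, Matroid.comapOn_indep_iff, Matroid.sum_indep_iff,
    Matroid.mapEmbedding_indep_iff]
  have h1 : ((Fin.valEmbedding : Fin t ↪ ℕ) ⁻¹' (Sum.inl ⁻¹' (itemProj t m '' I)))
      = {i : Fin t | (i : ℕ) ∈ I} := by
    ext i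
    simp only [Set.mem_preimage, Set.mem_image, Set.mem_ofPred_eq, Fin.valEmbedding_apply]
    constructor
    · rintro ⟨j, hj, h⟩
      unfold itemProj at h
      split_ifs at h
      cases h
      exact hj
    · intro h
      exact ⟨i, h, by simp [itemProj]⟩
  have h2 : Sum.inl ⁻¹' (itemProj t m '' I) ⊆ Set.range (Fin.valEmbedding : Fin t ↪ ℕ) := by
    rintro i ⟨j, hj, h⟩
    unfold itemProj at h
    split_ifs at h with h'
    cases h
    exact ⟨⟨_, h'⟩, rfl⟩
  simp only [h1, h2, and_true, Matroid.freeOn_indep_iff, Set.subset_univ]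
  refine and_congr_right fun _ => ?_
  constructor
  · rintro ⟨hi, hs⟩
    refine ⟨fun e he h => ?_, fun i hi => hs hi⟩
    have := hi h.1 h.2 (by
      unfold itemProj
      rw [if_neg (by omega), if_pos (by omega), if_neg (by omega), if_neg (by omega)]
      congr 1
      omega)
    omega
  · rintro ⟨hi, hs⟩
    refine ⟨?_, fun i hi => hs i hi⟩
    intro a ha b hb hab
    have ha' := hs a ha
    have hb' := hs b hb
    unfold itemProj at hab
    split_ifs at hab <;> simp only [Sum.inl.injEq, Sum.inr.injEq] at hab
    · exact hab
    · omega
    · exact absurd ⟨show t + (a - t) ∈ I by convert ha using 1; omega,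
        show t + m + (a - t) ∈ I by convert hb using 1; omega⟩ (hi _ (by omega))
    · exact absurd ⟨show t + (b - t) ∈ I by convert hb using 1; omega,
        show t + m + (b - t) ∈ I by convert ha using 1; omega⟩ (hi _ (by omega))
    · omega

theorem itemMatroid_ground : (itemMatroid M m).E = Set.Iio (t + m + m) := rfl

/-- A base of the item matroid contains a base of `M` and one half of each edge. -/
theorem itemMatroid_isBase_iff {B : Set ℕ} : (itemMatroid M m).IsBase B ↔
    M.IsBase {i : Fin t | (i : ℕ) ∈ B} ∧ (∀ e < m, t + m + e ∈ B ↔ t + e ∉ B) ∧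
      ∀ i ∈ B, i < t + m + m := by
  constructor
  · intro hB
    obtain ⟨h1, h2, h3⟩ := itemMatroid_indep_iff.1 hB.indep
    refine ⟨h1.isBase_of_forall_insert ?_, fun e he => ⟨fun h h' => h2 e he ⟨h', h⟩, fun h => ?_⟩,
      h3⟩
    · rintro e ⟨-, heB⟩ hi
      refine heB (hB.mem_of_insert_indep (e := (e : ℕ)) (itemMatroid_indep_iff.2 ⟨?_, ?_, ?_⟩))
      · convert hi using 1
        ext i
        simp [Fin.val_inj]
      · rintro a ha ⟨h, h'⟩
        have := e.2
        refine h2 a ha ⟨?_, ?_⟩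
        · rcases h with h | h
          · omega
          · exact h
        · rcases h' with h | h
          · omega
          · exact h
      · rintro i (rfl | hi)
        · omega
        · exact h3 i hi
    · refine hB.mem_of_insert_indep (itemMatroid_indep_iff.2 ⟨?_, ?_, ?_⟩)
      · convert h1 using 1
        ext i
        have := i.2
        simp only [Set.mem_ofPred_eq, Set.mem_insert_iff]
        exact or_iff_right (by omega)
      · rintro a ha ⟨h4, h5⟩
        rcases h4 with h4 | h4
        · omega
        · rcases h5 with h5 | h5
          · exact h (by rwa [show e = a by omega])
          · exact h2 a ha ⟨h4, h5⟩
      · rintro i (rfl | hi)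
        · omega
        · exact h3 i hi
  · rintro ⟨h1, h2, h3⟩
    refine (itemMatroid_indep_iff.2 ⟨h1.indep, fun e he h => (h2 e he).1 h.2 h.1, h3⟩
      ).isBase_of_forall_insert ?_
    rintro i ⟨hi, hiB⟩ hind
    rw [itemMatroid_ground, Set.mem_Iio] at hi
    obtain ⟨h4, h5, -⟩ := itemMatroid_indep_iff.1 hind
    by_cases hit : i < t
    · refine hiB (h1.mem_of_insert_indep (e := (⟨i, hit⟩ : Fin t)) ?_)
      convert h4 using 1
      ext j
      simp [Fin.ext_iff]
    · by_cases him : i < t + m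
      · have := (h2 (i - t) (by omega)).2 (by rwa [show t + (i - t) = i by omega])
        exact h5 (i - t) (by omega) ⟨Or.inl (by omega), Or.inr this⟩
      · have := (h2 (i - t - m) (by omega)).not.1
          (by rwa [show t + m + (i - t - m) = i by omega])
        exact h5 (i - t - m) (by omega) ⟨Or.inr (not_not.1 this), Or.inl (by omega)⟩

/-! ### Loads of the vertices -/

open Classical in
/-- The number of items among `0, …, g - 1` outside `B` that are located at `v`. -/
def load (g : ℕ) (loc : ℕ → ℕ) (B : Set ℕ) (v : ℕ) : ℕ :=
  ∑ i ∈ Finset.range g, if i ∉ B ∧ loc i = v then 1 else 0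

/-- The additive form avoids truncated subtraction and also covers `loc x = loc y`. -/
theorem load_exchange {g : ℕ} {loc : ℕ → ℕ} {B : Set ℕ} {x y : ℕ} (hxg : x < g) (hyg : y < g)
    (hx : x ∉ B) (hy : y ∈ B) (v : ℕ) :
    load g loc (insert x (B \ {y})) v + (if loc x = v then 1 else 0) =
      load g loc B v + (if loc y = v then 1 else 0) := by
  classical
  have h1 : ∀ z, z < g → (if loc z = v then 1 else 0) =
      ∑ i ∈ Finset.range g, if z = i then (if loc z = v then 1 else 0) else 0 := by
    intro z hz
    rw [Finset.sum_ite_eq, if_pos (Finset.mem_range.2 hz)]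
  rw [h1 x hxg, h1 y hyg]
  simp only [load]
  rw [← Finset.sum_add_distrib, ← Finset.sum_add_distrib]
  refine Finset.sum_congr rfl fun i _ => ?_
  have hxy : x ≠ y := by rintro rfl; exact hx hy
  by_cases hix : x = i
  · subst hix
    simp [hx, hxy.symm]
  · by_cases hiy : y = i
    · subst hiy
      simp [hy, hxy, hxy.symm]
    · simp [hix, hiy, Ne.symm hix, Ne.symm hiy]

/-- The function `loc` gives the positions of the items. -/
structure IsLoc (fst snd : Fin m → Fin n) (root : Fin t → Fin n) (loc : ℕ → ℕ) : Prop where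
  root_eq : ∀ i : Fin t, loc (i : ℕ) = root i
  fst_eq : ∀ e : Fin m, loc (t + (e : ℕ)) = fst e
  snd_eq : ∀ e : Fin m, loc (t + m + (e : ℕ)) = snd e

variable {fst snd : Fin m → Fin n} {root : Fin t → Fin n} {loc : ℕ → ℕ} {B : Set ℕ}

open Classical in
-- Exactly one half of each edge is outside `B`, so an edge is charged once, at the end where that
-- half lies.
theorem sum_load (hloc : IsLoc fst snd root loc)
    (hB : (itemMatroid M m).IsBase B) (X : Finset (Fin n)) :
    ∑ v ∈ X, load (t + m + m) loc B v =
      {r : Fin t | root r ∈ X ∧ (r : ℕ) ∉ B}.ncard +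
      ∑ e : Fin m, ((if t + (e : ℕ) ∉ B ∧ fst e ∈ X then 1 else 0) +
        if t + (e : ℕ) ∈ B ∧ snd e ∈ X then 1 else 0) := by
  have key : ∀ (P : Prop) [Decidable P] (w : Fin n),
      (∑ v ∈ X, if P ∧ ((w : ℕ) = (v : ℕ)) then 1 else 0) = if P ∧ w ∈ X then 1 else 0 := by
    intro P _ w
    by_cases hP : P <;> simp [hP, Fin.val_inj]
  simp only [load]
  rw [Finset.sum_comm, Finset.sum_range_add, Finset.sum_range_add, Finset.sum_add_distrib,
    add_assoc]
  simp only [Finset.sum_range, hloc.root_eq, hloc.fst_eq, hloc.snd_eq, key]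
  congr 1
  · rw [Set.ncard_eq_toFinset_card', Finset.sum_boole, Nat.cast_id]
    congr 1
    ext r
    simp [and_comm]
  · congr 1
    refine Finset.sum_congr rfl fun e _ => ?_
    simp only [(itemMatroid_isBase_iff.1 hB).2.1 e e.2, not_not]

/-- The edges of `F` and the roots in `V(F)` are covered by the loads. -/
theorem ncard_le_sum_load (hloc : IsLoc fst snd root loc)
    (hB : (itemMatroid M m).IsBase B) (F : Set (Fin m)) (X : Finset (Fin n))
    (hF : ∀ e ∈ F, fst e ∈ X ∧ snd e ∈ X) :
    F.ncard + (rootsIn root (X : Set (Fin n))).ncard ≤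
      ∑ v ∈ X, load (t + m + m) loc B v + rk M (rootsIn root X) := by
  classical
  rw [sum_load hloc hB]
  -- Both ends of an edge of `F` are in `X`, so it is charged to `X` whichever half is outside `B`.
  have h1 : F.ncard ≤ ∑ e : Fin m, ((if t + (e : ℕ) ∉ B ∧ fst e ∈ X then 1 else 0) +
        if t + (e : ℕ) ∈ B ∧ snd e ∈ X then 1 else 0) := by
    rw [Set.ncard_eq_toFinset_card', Finset.card_eq_sum_ones, ← Finset.sum_filter_add_sum_filter_not
      Finset.univ (fun e => e ∈ F)]
    refine le_trans ?_ (Nat.le_add_right _ _)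
    rw [show F.toFinset = Finset.univ.filter (fun e => e ∈ F) by ext; simp]
    refine Finset.sum_le_sum fun e he => ?_
    obtain ⟨h, h'⟩ := hF e (by simpa using he)
    by_cases hb : t + (e : ℕ) ∈ B <;> simp [hb, h, h']
  have h2 : (rootsIn root (X : Set (Fin n))).ncard ≤
      {r : Fin t | root r ∈ X ∧ (r : ℕ) ∉ B}.ncard + rk M (rootsIn root X) := by
    have h3 : rootsIn root (X : Set (Fin n)) = {r : Fin t | root r ∈ X ∧ (r : ℕ) ∉ B} ∪
        {r : Fin t | root r ∈ X ∧ (r : ℕ) ∈ B} := by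
      ext r
      simp only [rootsIn, Set.mem_ofPred_eq, Set.mem_union, Finset.mem_coe]
      tauto
    -- The roots of `X` that are not charged belong to the base, hence are independent.
    have h4 : {r : Fin t | root r ∈ X ∧ (r : ℕ) ∈ B}.ncard ≤ rk M (rootsIn root X) := by
      have hi : M.Indep {r : Fin t | root r ∈ X ∧ (r : ℕ) ∈ B} :=
        (itemMatroid_isBase_iff.1 hB).1.indep.subset fun r hr => hr.2
      rw [rk, Set.ncard]
      refine ENat.toNat_le_toNat ?_ ?_
      · exact hi.encard_le_eRk_of_subset fun r hr => hr.1
      · exact ((M.eRk_le_encard _).trans_lt (Set.toFinite _).encard_lt_top).ne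
    calc _ ≤ _ := h3 ▸ Set.ncard_union_le _ _
      _ ≤ _ := Nat.add_le_add_left h4 _
  omega

theorem arc_twin (hB : (itemMatroid M m).IsBase B) {e : ℕ} (he : e < m) {x y : ℕ}
    (hxy : x = t + e ∧ y = t + m + e ∨ x = t + m + e ∧ y = t + e) (hx : x ∉ B) :
    (itemMatroid M m).Arc B x y := by
  obtain ⟨hB1, hB2, hB3⟩ := itemMatroid_isBase_iff.1 hB
  have hy : y ∈ B := by
    rcases hxy with ⟨rfl, rfl⟩ | ⟨rfl, rfl⟩
    · exact (hB2 e he).2 hx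
    · exact not_not.1 fun h => hx ((hB2 e he).2 h)
  have hxg : x < t + m + m := by omega
  refine ⟨hxg, hx, hy, itemMatroid_indep_iff.2 ⟨?_, ?_, ?_⟩⟩
  · refine hB1.indep.subset ?_
    rintro r (hr | hr)
    · have := r.2
      omega
    · exact hr.1
  · rintro a ha ⟨h1, h2⟩
    have h3 := hB2 a ha
    simp only [Set.mem_insert_iff, Set.mem_sdiff, Set.mem_singleton_iff] at h1 h2
    by_cases hae : a = e
    · subst hae
      omega
    · have h4 := h1.resolve_left (by omega)
      have h5 := h2.resolve_left (by omega)
      exact h3.1 h5.1 h4.1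
  · rintro i (rfl | hi)
    · exact hxg
    · exact hB3 i hi.1

/-- The fundamental circuit of a half-edge is the pair of halves of its edge, and that of a root
contains only roots. Hence the oracle is needed for pairs of roots only. -/
theorem arc_iff (hB : (itemMatroid M m).IsBase B) {x y : ℕ} : (itemMatroid M m).Arc B x y ↔
    (x < t ∧ y < t ∧ x ∉ B ∧ y ∈ B ∧ M.Indep {i : Fin t | (i : ℕ) ∈ insert x (B \ {y})}) ∨
      ∃ e < m, (x = t + e ∧ y = t + m + e ∨ x = t + m + e ∧ y = t + e) ∧ x ∉ B := by
  obtain ⟨hB1, hB2, hB3⟩ := itemMatroid_isBase_iff.1 hB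
  constructor
  · rintro ⟨hx, hxB, hy, hi⟩
    rw [itemMatroid_ground, Set.mem_Iio] at hx
    obtain ⟨h1, h2, -⟩ := itemMatroid_indep_iff.1 hi
    have hyg := hB3 y hy
    by_cases hxt : x < t
    · refine Or.inl ⟨hxt, ?_, hxB, hy, h1⟩
      by_contra hyt
      refine hxB (hB1.mem_of_insert_indep (e := (⟨x, hxt⟩ : Fin t)) ?_)
      convert h1 using 1
      ext i
      have := i.2
      simp only [Set.mem_insert_iff, Set.mem_ofPred_eq, Fin.ext_iff, Set.mem_sdiff,
        Set.mem_singleton_iff]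
      refine or_congr_right ?_
      exact ⟨fun h => ⟨h, by omega⟩, fun h => h.1⟩
    · right
      by_cases hxm : x < t + m
      · obtain ⟨e, rfl⟩ : ∃ e, x = t + e := ⟨x - t, by omega⟩
        refine ⟨e, by omega, Or.inl ⟨rfl, ?_⟩, hxB⟩
        by_contra hne
        exact h2 e (by omega) ⟨Or.inl rfl, Or.inr ⟨(hB2 e (by omega)).2 hxB, fun h => hne h.symm⟩⟩
      · obtain ⟨e, rfl⟩ : ∃ e, x = t + m + e := ⟨x - t - m, by omega⟩
        refine ⟨e, by omega, Or.inr ⟨rfl, ?_⟩, hxB⟩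
        by_contra hne
        exact h2 e (by omega) ⟨Or.inr ⟨not_not.1 fun h => hxB ((hB2 e (by omega)).2 h),
          fun h => hne h.symm⟩, Or.inl rfl⟩
  · rintro (⟨hx, hy, hxB, hyB, hi⟩ | ⟨e, he, hxy, hx⟩)
    · refine ⟨by rw [itemMatroid_ground, Set.mem_Iio]; omega, hxB, hyB,
        itemMatroid_indep_iff.2 ⟨hi, ?_, ?_⟩⟩
      · rintro a ha ⟨h3, h4⟩
        exact (hB2 a ha).1 (h4.resolve_left (by omega)).1 (h3.resolve_left (by omega)).1
      · rintro i (rfl | hi)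
        · omega
        · exact hB3 i hi.1
    · exact arc_twin hB he hxy hx

/-- If `X` is closed under exchanges, then the loads in `X` only count edges in `X` and the excess
of the roots in `X` over their rank. -/
theorem sum_load_le (hloc : IsLoc fst snd root loc) (hM : M.E = Set.univ)
    (hB : (itemMatroid M m).IsBase B) (X : Finset (Fin n))
    (hX : ∀ x y, (itemMatroid M m).Arc B x y → ∀ v ∈ X, loc x = v → ∃ w ∈ X, loc y = w) :
    ∑ v ∈ X, load (t + m + m) loc B v + rk M (rootsIn root X) ≤
      {e | fst e ∈ X ∧ snd e ∈ X}.ncard + (rootsIn root (X : Set (Fin n))).ncard := by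
  classical
  obtain ⟨hB1, hB2, hB3⟩ := itemMatroid_isBase_iff.1 hB
  rw [sum_load hloc hB]
  have htwin := fun e he x y => arc_twin hB (e := e) he (x := x) (y := y)
  -- If the half outside `B` is in `X`, closedness under the swap of halves puts the other end in
  -- `X` too. So only edges inside `X` are charged.
  have h1 : ∑ e : Fin m, ((if t + (e : ℕ) ∉ B ∧ fst e ∈ X then 1 else 0) +
        (if t + (e : ℕ) ∈ B ∧ snd e ∈ X then 1 else 0)) ≤ {e | fst e ∈ X ∧ snd e ∈ X}.ncard := by
    rw [Set.ncard_eq_toFinset_card', show {e | fst e ∈ X ∧ snd e ∈ X}.toFinset =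
      Finset.univ.filter (fun e => fst e ∈ X ∧ snd e ∈ X) by ext; simp, Finset.card_filter]
    refine Finset.sum_le_sum fun e _ => ?_
    by_cases hb : t + (e : ℕ) ∈ B
    · by_cases hs : snd e ∈ X
      · obtain ⟨w, hw, hw'⟩ := hX _ _ (htwin e e.2 (t + m + e) (t + e) (Or.inr ⟨rfl, rfl⟩)
          fun h => (hB2 e e.2).1 h hb) _ hs (hloc.snd_eq e)
        rw [hloc.fst_eq, Fin.val_inj] at hw'
        simp [hb, hs, hw', hw]
      · simp [hb, hs]
    · by_cases hs : fst e ∈ X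
      · obtain ⟨w, hw, hw'⟩ := hX _ _ (htwin e e.2 (t + e) (t + m + e) (Or.inl ⟨rfl, rfl⟩) hb)
          _ hs (hloc.fst_eq e)
        rw [hloc.snd_eq, Fin.val_inj] at hw'
        simp [hb, hs, hw', hw]
      · simp [hb, hs]
  -- By closedness the fundamental circuit of a root in `X` stays in `X`, so the base roots in `X`
  -- span all roots in `X`.
  have hbasis : M.IsBasis {r : Fin t | root r ∈ X ∧ (r : ℕ) ∈ B} (rootsIn root X) := by
    set D : Set (Fin t) := {r : Fin t | (r : ℕ) ∈ B} with hD
    refine (hB1.indep.subset fun r hr => hr.2).isBasis_of_forall_insert (fun r hr => hr.1) ?_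
    rintro r ⟨hrX, hrB⟩
    have hrX' : root r ∈ X := hrX
    have hrD : r ∉ D := fun h => hrB ⟨hrX, h⟩
    have hrcl : r ∈ M.closure D := by rw [hB1.closure_eq, hM]; trivial
    have hC := hB1.indep.fundCircuit_isCircuit hrcl hrD
    refine hC.dep.superset ?_ (by rw [hM]; exact Set.subset_univ _)
    intro y hy
    rcases M.fundCircuit_subset_insert r D hy with rfl | hyD
    · exact Set.mem_insert _ _
    · refine Set.mem_insert_of_mem _ ⟨?_, hyD⟩
      have hi := (hB1.indep.mem_fundCircuit_iff hrcl hrD).1 hy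
      have hyr : r ≠ y := by rintro rfl; exact hrD hyD
      have harc : (itemMatroid M m).Arc B r y := by
        refine ⟨by rw [itemMatroid_ground, Set.mem_Iio]; omega, hrD, hyD,
          itemMatroid_indep_iff.2 ⟨?_, ?_, ?_⟩⟩
        · convert hi using 1
          ext i
          by_cases hir : i = r
          · simp [hir, hyr]
          · simp [hD, hir, Fin.val_inj]
        · rintro a ha ⟨h3, h4⟩
          have := r.2
          refine (hB2 a ha).1 (h4.resolve_left (by omega)).1 (h3.resolve_left (by omega)).1
        · rintro i (rfl | hi)
          · have := r.2
            omega
          · exact hB3 i hi.1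
      obtain ⟨w, hw, hw'⟩ := hX r y harc _ hrX' (hloc.root_eq r)
      rw [hloc.root_eq, Fin.val_inj] at hw'
      rwa [hw']
  have h2 : {r : Fin t | root r ∈ X ∧ (r : ℕ) ∉ B}.ncard + rk M (rootsIn root X) =
      (rootsIn root (X : Set (Fin n))).ncard := by
    have h3 : rootsIn root (X : Set (Fin n)) = {r : Fin t | root r ∈ X ∧ (r : ℕ) ∉ B} ∪
        {r : Fin t | root r ∈ X ∧ (r : ℕ) ∈ B} := by
      ext r
      simp only [rootsIn, Set.mem_ofPred_eq, Set.mem_union, Finset.mem_coe]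
      tauto
    have h4 : rk M (rootsIn root X) = {r : Fin t | root r ∈ X ∧ (r : ℕ) ∈ B}.ncard := by
      rw [rk, Set.ncard, hbasis.encard_eq_eRk]
    rw [h4, h3, Set.ncard_union_eq]
    rw [Set.disjoint_left]
    exact fun r hr hr' => hr.2 hr'.2
  omega

/-! ### From loads to the counting conditions -/

theorem mem_span_iff {G : Graph (Fin n) (Fin m)} (hG : ∀ e, G.IsLink e (fst e) (snd e))
    {F : Set (Fin m)} {v : Fin n} : v ∈ span G F ↔ ∃ e ∈ F, v = fst e ∨ v = snd e := by
  refine ⟨?_, ?_⟩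
  · rintro ⟨e, he, w, h⟩
    exact ⟨e, he, h.left_eq_or_eq (hG e)⟩
  · rintro ⟨e, he, rfl | rfl⟩
    · exact ⟨e, he, (hG e).inc_left⟩
    · exact ⟨e, he, (hG e).inc_right⟩

/-- If each vertex can be freed of its load while the other loads stay bounded by the rank, then
the first two conditions hold. -/
theorem C1_and_C2_of_isBase {G : Graph (Fin n) (Fin m)} (hG : ∀ e, G.IsLink e (fst e) (snd e))
    (hloc : IsLoc fst snd root loc)
    (h : ∀ v < n, ∃ B, (itemMatroid M m).IsBase B ∧ load (t + m + m) loc B v = 0 ∧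
      ∀ w < n, load (t + m + m) loc B w ≤ rank M) : C1 G root M ∧ C2 G root M := by
  classical
  constructor
  · intro v _
    obtain ⟨B, hB, h0, -⟩ := h v v.2
    refine (itemMatroid_isBase_iff.1 hB).1.indep.subset fun r hr => ?_
    have hr' : root r = v := hr
    have hr2 := r.2
    have := Finset.sum_eq_zero_iff.1 h0 (r : ℕ) (by rw [Finset.mem_range]; omega)
    by_contra hrB
    have hrB' : (r : ℕ) ∉ B := hrB
    rw [if_pos ⟨hrB', by rw [hloc.root_eq, hr']⟩] at this
    omega
  · intro F _ hF
    obtain ⟨X, hX⟩ : ∃ X : Finset (Fin n), (X : Set (Fin n)) = span G F :=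
      ⟨(span G F).toFinset, by simp⟩
    have hmem : ∀ e ∈ F, fst e ∈ X ∧ snd e ∈ X := by
      intro e he
      rw [← Finset.mem_coe, ← Finset.mem_coe, hX, mem_span_iff hG, mem_span_iff hG]
      exact ⟨⟨e, he, Or.inl rfl⟩, ⟨e, he, Or.inr rfl⟩⟩
    obtain ⟨e, he⟩ := hF
    -- Freeing a vertex of `V(F)` itself is what yields the summand `-k` of (C2).
    obtain ⟨B, hB, h0, hk⟩ := h (fst e) (fst e).2
    have h1 := ncard_le_sum_load hloc hB F X hmem
    have h2 : ∑ v ∈ X, load (t + m + m) loc B v ≤ (X.card - 1) * rank M := by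
      rw [← Finset.add_sum_erase X _ (hmem e he).1, h0, zero_add,
        ← Finset.card_erase_of_mem (hmem e he).1]
      exact Finset.sum_le_card_nsmul _ _ _ fun v _ => hk v v.2
    have h3 : 1 ≤ X.card := Finset.card_pos.2 ⟨_, (hmem e he).1⟩
    rw [← hX, Set.ncard_coe_finset]
    obtain ⟨c, hc⟩ : ∃ c, X.card = c + 1 := ⟨X.card - 1, by omega⟩
    rw [hc] at h2 ⊢
    rw [Nat.add_sub_cancel] at h2
    zify at h1 h2
    push_cast
    linarith

theorem rk_mono (M : Matroid (Fin t)) {X Y : Set (Fin t)} (h : X ⊆ Y) : rk M X ≤ rk M Y :=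
  ENat.toNat_le_toNat (M.eRk_mono h)
    ((M.eRk_le_encard _).trans_lt (Set.toFinite _).encard_lt_top).ne

theorem rk_le_rank (M : Matroid (Fin t)) (X : Set (Fin t)) : rk M X ≤ rank M :=
  ENat.toNat_le_toNat (M.eRk_le_eRank X) (by
    obtain ⟨B, hB⟩ := M.exists_isBase
    rw [← hB.encard_eq_eRank]
    exact (Set.toFinite _).encard_lt_top.ne)

theorem ncard_rootsIn_insert (root : Fin t → Fin n) {v : Fin n} {X : Finset (Fin n)} (hv : v ∉ X) :
    (rootsIn root ((insert v X : Finset (Fin n)) : Set (Fin n))).ncard =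
      (rootsIn root {v}).ncard + (rootsIn root (X : Set (Fin n))).ncard := by
  rw [← Set.ncard_union_eq]
  · congr 1
    ext r
    simp [rootsIn]
  · rw [Set.disjoint_left]
    intro r hr hr'
    have h1 : root r = v := hr
    have h2 : root r ∈ X := hr'
    exact hv (h1 ▸ h2)

/-- Under (C1), the roots outside a set of vertices satisfy the obvious counting bound. -/
theorem ncard_rootsIn_union_le {root : Fin t → Fin n}
    (h : ∀ v, M.Indep (rootsIn root {v})) (X Y : Finset (Fin n)) (hXY : X ⊆ Y) :
    (rootsIn root (Y : Set (Fin n))).ncard + rank M * X.card ≤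
      (rootsIn root (X : Set (Fin n))).ncard + rank M * Y.card := by
  classical
  have key : ∀ Z : Finset (Fin n), (rootsIn root ((X ∪ Z : Finset (Fin n)) : Set (Fin n))).ncard +
      rank M * X.card ≤ (rootsIn root (X : Set (Fin n))).ncard + rank M * (X ∪ Z).card := by
    intro Z
    induction Z using Finset.induction_on with
    | empty => simp
    | insert v Z _ ih =>
      rw [Finset.union_insert]
      by_cases hv : v ∈ X ∪ Z
      · rwa [Finset.insert_eq_of_mem hv]
      · rw [ncard_rootsIn_insert root hv, Finset.card_insert_of_notMem hv]
        have : (rootsIn root {v}).ncard ≤ rank M := by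
          refine le_trans (le_of_eq ?_) (rk_le_rank M (rootsIn root {v}))
          rw [rk, (h v).eRk_eq_encard, Set.ncard]
        rw [Nat.mul_add, Nat.mul_one]
        omega
  have := key Y
  rwa [Finset.union_eq_right.2 hXY] at this

/-- A set of vertices closed under exchanges that has too much load violates the conditions. -/
theorem not_C1_and_C2_of_closed {G : Graph (Fin n) (Fin m)}
    (hG : ∀ e, G.IsLink e (fst e) (snd e)) (hV : V(G) = Set.univ) (hE : E(G) = Set.univ)
    (hloc : IsLoc fst snd root loc) (hM : M.E = Set.univ) (hB : (itemMatroid M m).IsBase B)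
    (X : Set ℕ) (hX : ∀ x y, (itemMatroid M m).Arc B x y → loc x ∈ X → loc y ∈ X)
    (v₀ : ℕ) (hv₀ : v₀ < n) (hv₀X : v₀ ∈ X) (hload₀ : load (t + m + m) loc B v₀ ≠ 0)
    (hload : ∀ v < n, v ∈ X → v ≠ v₀ → rank M ≤ load (t + m + m) loc B v) :
    ¬ (C1 G root M ∧ C2 G root M) := by
  classical
  rintro ⟨h1, h2⟩
  replace h1 : ∀ v, M.Indep (rootsIn root {v}) := fun v => h1 v (by rw [hV]; trivial)
  have hlt : ∀ x y, (itemMatroid M m).Arc B x y → loc y < n := by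
    intro x y h
    have hy : y < t + m + m := (itemMatroid_isBase_iff.1 hB).2.2 y h.2.2.1
    by_cases hyt : y < t
    · exact (hloc.root_eq ⟨y, hyt⟩) ▸ Fin.is_lt _
    · by_cases hym : y < t + m
      · have := hloc.fst_eq ⟨y - t, by omega⟩
        simp only [show t + (y - t) = y by omega] at this
        exact this ▸ Fin.is_lt _
      · have := hloc.snd_eq ⟨y - t - m, by omega⟩
        simp only [show t + m + (y - t - m) = y by omega] at this
        exact this ▸ Fin.is_lt _
  let Y : Finset (Fin n) := Finset.univ.filter fun v => (v : ℕ) ∈ X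
  have hY : ∀ v : Fin n, v ∈ Y ↔ (v : ℕ) ∈ X := by simp [Y]
  have hle := sum_load_le hloc hM hB Y (by
    intro x y h v hv hvx
    exact ⟨⟨loc y, hlt x y h⟩, (hY _).2 (hX x y h (hvx ▸ (hY v).1 hv)), rfl⟩)
  have hvY : (⟨v₀, hv₀⟩ : Fin n) ∈ Y := (hY _).2 hv₀X
  -- The extra unit at `v₀` is the contradiction: the conditions leave room for `(|Y| - 1) k` only.
  have hge : (Y.card - 1) * rank M + 1 ≤ ∑ v ∈ Y, load (t + m + m) loc B v := by
    rw [← Finset.add_sum_erase Y _ hvY, ← Finset.card_erase_of_mem hvY, add_comm]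
    refine Nat.add_le_add (Nat.one_le_iff_ne_zero.2 hload₀)
      (Finset.card_nsmul_le_sum _ _ _ fun v hv => ?_)
    rw [Finset.mem_erase] at hv
    exact hload v v.2 ((hY v).1 hv.2) fun h => hv.1 (Fin.ext h)
  obtain ⟨c, hc⟩ : ∃ c, Y.card = c + 1 := ⟨Y.card - 1, by
    have := Finset.card_pos.2 ⟨_, hvY⟩
    omega⟩
  rw [hc, Nat.add_sub_cancel] at hge
  set F : Set (Fin m) := {e | fst e ∈ Y ∧ snd e ∈ Y} with hFdef
  by_cases hF : F.Nonempty
  · obtain ⟨Z, hZ⟩ : ∃ Z : Finset (Fin n), (Z : Set (Fin n)) = span G F :=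
      ⟨(span G F).toFinset, by simp⟩
    have h3 := h2 F (by rw [hE]; exact Set.subset_univ _) hF
    rw [← hZ, Set.ncard_coe_finset] at h3
    -- `V(F)` may be smaller than `Y`. By (C1) each vertex of `Y` outside it carries at most `k`
    -- roots, so the violation found at `Y` passes to `V(F)`.
    have hZY : Z ⊆ Y := by
      intro v hv
      rw [← Finset.mem_coe, hZ, mem_span_iff hG] at hv
      obtain ⟨e, he, rfl | rfl⟩ := hv
      · exact he.1
      · exact he.2
    have h4 := ncard_rootsIn_union_le h1 Z Y hZY
    have h5 : rk M (rootsIn root (Z : Set (Fin n))) ≤ rk M (rootsIn root (Y : Set (Fin n))) :=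
      rk_mono M fun r hr => hZY hr
    rw [hc] at h4
    zify at h4 h5 hge hle
    linarith
  -- With no edge inside `Y`, (C2) says nothing; (C1) at `v₀` takes its place, as the roots there
  -- number at most the rank of those in `Y`.
  · rw [Set.not_nonempty_iff_eq_empty.1 hF, Set.ncard_empty] at hle
    have h4 := ncard_rootsIn_union_le h1 {⟨v₀, hv₀⟩} Y (by simpa using hvY)
    have h5 : (rootsIn root (({⟨v₀, hv₀⟩} : Finset (Fin n)) : Set (Fin n))).ncard ≤
        rk M (rootsIn root (Y : Set (Fin n))) := by
      rw [Finset.coe_singleton, Set.ncard, ← (h1 _).eRk_eq_encard]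
      refine rk_mono M fun r hr => ?_
      have : root r = ⟨v₀, hv₀⟩ := hr
      exact show root r ∈ Y from this ▸ hvY
    rw [hc, Finset.card_singleton] at h4
    zify at h4 h5 hge hle
    linarith

end RootedGraph

namespace OracleRAM

open RootedGraph

variable {n m t Q : ℕ} {M : Matroid (Fin t)}

/-- The set whose characteristic vector is stored in array `3`. -/
def State.items (s : State) : Set ℕ := {i | s.arr 3 i ≠ 0}

/-! ### A base of the matroid -/

/-- One step of the greedy algorithm: try to add the root in register `4`. -/
def greedyStep : Prog :=
  .seq (.store 3 (.reg 4) (.const 1)) <| .seq (.query 5 3) <|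
    .ite (.reg 5) (.assign 3 (.add (.reg 3) (.const 1))) (.store 3 (.reg 4) (.const 0))

/-- Computes a base of the matroid in array `3` and its rank in register `3`. -/
def greedy : Prog := .seq (.assign 3 (.const 0)) (forLoop 4 (.reg 2) greedyStep)

/-- The selected roots always form a basis of the roots tried so far. -/
theorem runs_greedy (hM : M.E = Set.univ) (hQ : 1 ≤ Q) {s : State} (ht : s.reg 2 = t)
    (h0 : ∀ i, s.arr 3 i = 0) :
    Runs (indepOracle M) Q greedy s (30 * (t + 1) * Q) fun s' =>
      M.IsBase {i : Fin t | s'.arr 3 i ≠ 0} ∧ (∀ i, s'.arr 3 i ≤ 1) ∧ (∀ i, t ≤ i → s'.arr 3 i = 0) ∧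
      s'.reg 3 = rank M := by
  have hcost : 2 + (t * (18 + Q + 1 + 7) + 1 + 5) ≤ 30 * (t + 1) * Q := by
    obtain ⟨q, rfl⟩ : ∃ q, Q = q + 1 := ⟨Q - 1, by omega⟩
    ring_nf
    nlinarith [Nat.zero_le (t * q)]
  refine Runs.mono (Runs.seq (mid := fun s' => s' = s.setReg 3 0)
    ⟨_, _, Exec.assign _ _ _, le_rfl, rfl⟩ ?_) hcost fun _ _ h => h
  rintro s' - rfl
  refine Runs.mono (Runs.forLoop t (18 + Q) (fun j s' =>
    M.IsBasis {i : Fin t | s'.arr 3 i ≠ 0} {i : Fin t | (i : ℕ) < j} ∧ (∀ i, s'.arr 3 i ≤ 1) ∧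
      (∀ i, j ≤ i → s'.arr 3 i = 0) ∧ s'.reg 3 = {i : Fin t | s'.arr 3 i ≠ 0}.ncard)
      ?_ ?_ ?_ ?_) le_rfl ?_
  · simp [greedyStep, Prog.regs]
  · intro s' hf
    simpa [Expr.eval, State.setReg, ht] using
      hf.1 2 (by simp [forLoop, greedyStep, Prog.regs])
  · simp [State.setReg, h0]
  · rintro j s' hj ⟨hb, hle, hz, hk⟩ hj' -
    refine Runs.straight (by simp [greedyStep, Prog.LoopFree])
      (by simp [greedyStep, Prog.timeBound, Expr.cost]; omega) ?_
    have hins : {i : Fin t | (Function.update (s'.arr 3) j 1) i ≠ 0} =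
        insert (⟨j, hj⟩ : Fin t) {i : Fin t | s'.arr 3 i ≠ 0} := by
      ext i
      simp only [Function.update_apply, Set.mem_ofPred_eq, Set.mem_insert_iff, Fin.ext_iff]
      by_cases h : (i : ℕ) = j <;> simp [h]
    have hins' : {i : Fin t | (i : ℕ) < j + 1} =
        insert (⟨j, hj⟩ : Fin t) {i : Fin t | (i : ℕ) < j} := by
      ext i
      simp only [Set.mem_ofPred_eq, Set.mem_insert_iff, Fin.ext_iff]
      omega
    have hnot : (⟨j, hj⟩ : Fin t) ∉ {i : Fin t | s'.arr 3 i ≠ 0} := by simp [hz j le_rfl]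
    by_cases hi : M.Indep (insert (⟨j, hj⟩ : Fin t) {i : Fin t | s'.arr 3 i ≠ 0})
    · have hO : indepOracle M (Function.update (s'.arr 3) j 1) := by rwa [indepOracle, hins]
      simp only [greedyStep, Prog.run, Expr.eval, State.setReg_reg, State.setReg_arr,
        State.setArr_reg, State.setArr_arr, hj', hO, if_true, ne_eq, one_ne_zero, not_false_eq_true,
        Nat.reduceEqDiff, if_false]
      refine ⟨?_, ?_, ?_, ?_⟩
      · rw [hins, hins']
        exact hb.insert_isBasis_insert hi
      · intro i
        by_cases h : i = j <;> simp [h, hle]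
      · intro i hi'
        rw [Function.update_of_ne (by omega)]
        exact hz i (by omega)
      · rw [hins, Set.ncard_insert_of_notMem hnot, hk]
    · have hO : ¬ indepOracle M (Function.update (s'.arr 3) j 1) := by rwa [indepOracle, hins]
      -- A failed trial is undone exactly, since the entry was `0` before.
      have hback : Function.update (s'.arr 3) j 0 = s'.arr 3 := by
        rw [← hz j le_rfl, Function.update_eq_self]
      simp only [greedyStep, Prog.run, Expr.eval, State.setReg_reg, State.setReg_arr,
        State.setArr_reg, State.setArr_arr, hj', hO, if_true, ne_eq, not_true_eq_false,
        Nat.reduceEqDiff, if_false, Function.update_idem, hback]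
      refine ⟨?_, hle, fun i hi' => hz i (by omega), hk⟩
      rw [hins']
      refine hb.indep.isBasis_of_forall_insert (fun i hi' => Or.inr (hb.subset hi')) ?_
      rintro i ⟨rfl | hi', hi''⟩
      · rw [← Matroid.not_indep_iff (by rw [hM]; exact Set.subset_univ _)]
        exact hi
      · exact hb.insert_dep ⟨hi', hi''⟩
  · rintro s' - ⟨⟨hb, hle, hz, hk⟩, -⟩
    have hb' : M.IsBase {i : Fin t | s'.arr 3 i ≠ 0} := by
      rw [← Matroid.isBasis_ground_iff, hM]
      convert hb using 1
      ext i
      simp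
    refine ⟨hb', hle, hz, ?_⟩
    rw [hk, Set.ncard, rank, hb'.encard_eq_eRank]

/-! ### Positions and loads of the items -/

/-- Stores the positions of the roots in array `4`. -/
def rootPositions : Prog := forLoop 4 (.reg 2) (.store 4 (.reg 4) (.get 2 (.reg 4)))

/-- Stores the positions of the half-edges in array `4` and selects the first half of each edge. -/
def edgePositions : Prog := forLoop 4 (.reg 1) <|
  .seq (.store 4 (.add (.reg 2) (.reg 4)) (.get 0 (.reg 4))) <|
  .seq (.store 4 (.add (.add (.reg 2) (.reg 1)) (.reg 4)) (.get 1 (.reg 4)))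
    (.store 3 (.add (.reg 2) (.reg 4)) (.const 1))

/-- Stores the loads of the vertices in array `5`. -/
def computeLoads : Prog := forLoop 4 (.add (.add (.reg 2) (.reg 1)) (.reg 1)) <|
  .ite (.get 3 (.reg 4)) .skip
    (.store 5 (.get 4 (.reg 4)) (.add (.get 5 (.get 4 (.reg 4))) (.const 1)))

theorem runs_rootPositions {O : (ℕ → ℕ) → Prop} {root : Fin t → Fin n} {s : State}
    (ht : s.reg 2 = t) (hr : s.arr 2 = arrayOf root) :
    Runs O Q rootPositions s (20 * (t + 1)) fun s' => ∀ i : Fin t, s'.arr 4 i = root i := by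
  refine Runs.mono (Runs.forLoop t 5 (fun j s' => ∀ i : Fin t, (i : ℕ) < j → s'.arr 4 i = root i)
    ?_ ?_ ?_ ?_) ?_ ?_
  · simp
  · intro s' hf
    simpa [ht] using hf.1 2 (by simp [forLoop])
  · simp
  · intro j s' hj hI hj' hf
    refine Runs.straight (by simp) (by simp) ?_
    have h2 : s'.arr 2 = arrayOf root := (hf.2 2 (by simp [forLoop])).trans hr
    intro i hi
    simp only [Prog.run, Expr.eval, State.setArr_arr, State.setReg_arr, if_true, hj',
      Function.update_apply, h2]
    split_ifs with h
    · simp [arrayOf, ← h]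
    · exact hI i (by omega)
  · simp only [Expr.cost]
    omega
  · rintro s' - ⟨h, -⟩ i
    exact h i i.2

theorem runs_edgePositions {O : (ℕ → ℕ) → Prop} {fst snd : Fin m → Fin n} {s : State}
    (hm : s.reg 1 = m) (ht : s.reg 2 = t) (hf : s.arr 0 = arrayOf fst) (hs : s.arr 1 = arrayOf snd) :
    Runs O Q edgePositions s (50 * (m + 1)) fun s' =>
      (∀ i < t, s'.arr 4 i = s.arr 4 i) ∧ (∀ e : Fin m, s'.arr 4 (t + e) = fst e) ∧
      (∀ e : Fin m, s'.arr 4 (t + m + e) = snd e) ∧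
      ∀ i, s'.arr 3 i = if t ≤ i ∧ i < t + m then 1 else s.arr 3 i := by
  refine Runs.mono (Runs.forLoop m 22 (fun j s' =>
    (∀ i < t, s'.arr 4 i = s.arr 4 i) ∧ (∀ e : Fin m, (e : ℕ) < j → s'.arr 4 (t + e) = fst e) ∧
      (∀ e : Fin m, (e : ℕ) < j → s'.arr 4 (t + m + e) = snd e) ∧
      ∀ i, s'.arr 3 i = if t ≤ i ∧ i < t + j then 1 else s.arr 3 i)
    ?_ ?_ ?_ ?_) ?_ ?_
  · simp
  · intro s' hf
    simpa [hm] using hf.1 1 (by simp [forLoop])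
  · simp only [State.setReg_arr, implies_true, true_and, Nat.not_lt_zero, false_implies]
    intro i
    rw [if_neg (by omega)]
  · rintro j s' hj ⟨h1, h2, h3, h4⟩ hj' hfr
    refine Runs.straight (by simp) (by simp) ?_
    have hf' : s'.arr 0 = arrayOf fst := (hfr.2 0 (by simp [forLoop])).trans hf
    have hs' : s'.arr 1 = arrayOf snd := (hfr.2 1 (by simp [forLoop])).trans hs
    have hm' : s'.reg 1 = m := (hfr.1 1 (by simp [forLoop])).trans hm
    have ht' : s'.reg 2 = t := (hfr.1 2 (by simp [forLoop])).trans ht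
    simp only [Prog.run, Expr.eval, State.setArr_arr, State.setArr_reg, State.setReg_arr, if_true,
      hj', hf', hs', hm', ht', Function.update_apply, Nat.reduceEqDiff, if_false,
      OfNat.one_ne_ofNat]
    refine ⟨?_, ?_, ?_, ?_⟩
    · intro i hi
      rw [if_neg (by omega), if_neg (by omega)]
      exact h1 i hi
    · intro e he
      rw [if_neg (by omega)]
      split_ifs with h
      · simp [arrayOf, show j = (e : ℕ) by omega]
      · exact h2 e (by omega)
    · intro e he
      split_ifs with h h'
      · simp [arrayOf, show j = (e : ℕ) by omega]
      · omega
      · exact h3 e (by omega)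
    · intro i
      rw [h4]
      split_ifs <;> first | rfl | omega
  · simp only [Expr.cost]
    omega
  · rintro s' - ⟨⟨h1, h2, h3, h4⟩, -⟩
    exact ⟨h1, fun e => h2 e e.2, fun e => h3 e e.2, h4⟩

theorem runs_computeLoads {O : (ℕ → ℕ) → Prop} {s : State}
    (hm : s.reg 1 = m) (ht : s.reg 2 = t) (h0 : ∀ v, s.arr 5 v = 0) :
    Runs O Q computeLoads s (60 * (t + m + m + 1)) fun s' =>
      ∀ v, s'.arr 5 v = load (t + m + m) (s.arr 4) s.items v := by
  classical
  refine Runs.mono (Runs.forLoop (t + m + m) 13 (fun j s' =>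
    ∀ v, s'.arr 5 v = load j (s.arr 4) s.items v) ?_ ?_ ?_ ?_) ?_ ?_
  · simp
  · intro s' hf
    have := hf.1 1 (by simp [forLoop])
    have := hf.1 2 (by simp [forLoop])
    simp [*]
  · simp [load, h0]
  · intro j s' hj hI hj' hf
    refine Runs.straight (by simp) (by simp) ?_
    have h3 : s'.arr 3 = s.arr 3 := hf.2 3 (by simp [forLoop])
    have h4 : s'.arr 4 = s.arr 4 := hf.2 4 (by simp [forLoop])
    intro v
    have hv := hI v
    rw [load] at hv ⊢
    rw [Finset.sum_range_succ, ← hv]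
    by_cases hB : s.arr 3 j = 0
    · by_cases hv' : v = s.arr 4 j
      · simp [hj', h3, h4, hB, hv', State.items]
      · simp [hj', h3, h4, hB, hv', State.items, Ne.symm hv']
    · simp [hj', h3, hB, State.items]
  · simp only [Expr.cost]
    omega
  · rintro s' - ⟨h, -⟩
    exact h

end OracleRAM

namespace OracleRAM

open RootedGraph

variable {n m t Q : ℕ} {M : Matroid (Fin t)}

/-! ### The list of all exchanges -/

/-- The pair `(p, q)` occurs in the list of pairs in arrays `12` and `13`. -/
def State.Listed (s : State) (p q : ℕ) : Prop :=
  ∃ j < s.reg 6, s.arr 12 j = p ∧ s.arr 13 j = q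

/-- Appends a pair to the list. -/
def addArc (e f : Expr) : Prog :=
  .seq (.store 12 (.reg 6) e) <| .seq (.store 13 (.reg 6) f) <|
    .assign 6 (.add (.reg 6) (.const 1))

theorem exists_lt_update_iff {N : ℕ} {f g : ℕ → ℕ} {p₀ q₀ p q : ℕ} :
    (∃ j < N + 1, Function.update f N p₀ j = p ∧ Function.update g N q₀ j = q) ↔
      (∃ j < N, f j = p ∧ g j = q) ∨ (p = p₀ ∧ q = q₀) := by
  constructor
  · rintro ⟨j, hj, h1, h2⟩
    by_cases h : j = N
    · subst h
      rw [Function.update_self] at h1 h2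
      exact Or.inr ⟨h1.symm, h2.symm⟩
    · rw [Function.update_of_ne h] at h1 h2
      exact Or.inl ⟨j, by omega, h1, h2⟩
  · rintro (⟨j, hj, h1, h2⟩ | ⟨rfl, rfl⟩)
    · exact ⟨j, by omega, by rw [Function.update_of_ne (by omega), h1],
        by rw [Function.update_of_ne (by omega), h2]⟩
    · exact ⟨N, by omega, by simp, by simp⟩

/-- Asks the oracle whether the root in register `10` may be exchanged for that in register `9`. -/
def testPair : Prog := .ite (.get 3 (.reg 10))
  (.seq (.store 3 (.reg 9) (.const 1)) <| .seq (.store 3 (.reg 10) (.const 0)) <|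
    .seq (.query 5 3) <| .seq (.store 3 (.reg 9) (.const 0)) <|
    .seq (.store 3 (.reg 10) (.const 1)) <|
    .ite (.reg 5) (addArc (.reg 9) (.reg 10)) .skip)
  .skip

/-- Lists the exchanges for the root in register `9`. -/
def rootArcsFrom : Prog := .ite (.get 3 (.reg 9)) .skip (forLoop 10 (.reg 2) testPair)

/-- Lists the exchanges of roots. -/
def rootArcs : Prog := .seq (.assign 6 (.const 0)) (forLoop 9 (.reg 2) rootArcsFrom)

/-- Lists the exchanges of half-edges. -/
def edgeArcs : Prog := forLoop 9 (.reg 1) <| .ite (.get 3 (.add (.reg 2) (.reg 9)))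
  (addArc (.add (.add (.reg 2) (.reg 1)) (.reg 9)) (.add (.reg 2) (.reg 9)))
  (addArc (.add (.reg 2) (.reg 9)) (.add (.add (.reg 2) (.reg 1)) (.reg 9)))

/-- The oracle sees only the entries below `t`, so the half-edges stored in the same array do not
disturb the test. -/
theorem arc_iff_indepOracle {f : ℕ → ℕ} (hB : (itemMatroid M m).IsBase {i | f i ≠ 0})
    {x y : ℕ} (hx : x < t) (hy : y < t) (hfx : f x = 0) (hfy : f y ≠ 0) :
    (itemMatroid M m).Arc {i | f i ≠ 0} x y ↔
      indepOracle M (Function.update (Function.update f x 1) y 0) := by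
  have hset : {i : Fin t | (i : ℕ) ∈ insert x ({i | f i ≠ 0} \ {y})} =
      {i : Fin t | Function.update (Function.update f x 1) y 0 i ≠ 0} := by
    ext i
    have hxy : x ≠ y := by rintro rfl; exact hfy hfx
    by_cases hiy : (i : ℕ) = y
    · simp [hiy, hxy.symm]
    · by_cases hix : (i : ℕ) = x <;> simp [hiy, hix, hxy]
  rw [arc_iff hB, hset, indepOracle]
  constructor
  · rintro (h | ⟨e, he, h, -⟩)
    · exact h.2.2.2.2
    · omega
  · intro h
    exact Or.inl ⟨hx, hy, by simpa using hfx, hfy, h⟩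

/-- The nested loops treat the pairs `(p, q)` in lexicographic order and restore the characteristic
vector after each test. The bound `t * t` on the list length enters the time of the search. -/
theorem runs_rootArcs {s : State} (ht : s.reg 2 = t) (hQ : 1 ≤ Q)
    (hB : (itemMatroid M m).IsBase s.items) (hle : ∀ i, s.arr 3 i ≤ 1) :
    Runs (indepOracle M) Q rootArcs s (100 * (t + 1) ^ 2 * Q) fun s' =>
      s'.arr 3 = s.arr 3 ∧ s'.reg 6 ≤ t * t ∧
      ∀ p q, s'.Listed p q ↔ (itemMatroid M m).Arc s.items p q ∧ p < t := by
  have hcost : 2 + (t * (3 + (t * (38 + Q + 1 + 7) + 1 + 5) + 1 + 7) + 1 + 5) ≤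
      100 * (t + 1) ^ 2 * Q := by
    obtain ⟨q, rfl⟩ : ∃ q, Q = q + 1 := ⟨Q - 1, by omega⟩
    ring_nf
    nlinarith [Nat.zero_le (t * q), Nat.zero_le (t ^ 2 * q)]
  -- The exchange partners of a root are roots, so the inner loop misses none.
  have hlt : ∀ {p q : ℕ}, (itemMatroid M m).Arc s.items p q → p < t → q < t := by
    intro p q h hp
    rcases (arc_iff hB).1 h with h | ⟨e, he, h, -⟩
    · exact h.2.1
    · omega
  refine Runs.mono (Runs.seq (mid := fun s' => s' = s.setReg 6 0)
    ⟨_, _, Exec.assign _ _ _, le_rfl, rfl⟩ ?_) hcost fun _ _ h => h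
  rintro _ - rfl
  refine Runs.mono (Runs.forLoop t (3 + (t * (38 + Q + 1 + 7) + 1 + 5)) (fun x s' =>
    s'.arr 3 = s.arr 3 ∧ s'.reg 6 ≤ x * t ∧
      ∀ p q, s'.Listed p q ↔ (itemMatroid M m).Arc s.items p q ∧ p < t ∧ p < x) ?_ ?_ ?_ ?_)
      le_rfl ?_
  · simp [rootArcsFrom, testPair, addArc, forLoop]
  · intro s' hf
    simpa [ht] using hf.1 2 (by simp [rootArcsFrom, testPair, addArc, forLoop])
  · simp [State.Listed]
  · rintro x s' hx ⟨h3, hN, hL⟩ hx' hf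
    have ht' : s'.reg 2 = t := (hf.1 2 (by simp [rootArcsFrom, testPair, addArc, forLoop])).trans
      (by simpa using ht)
    refine Runs.ite (b := .get 3 (.reg 9)) (fun hb => ?_) (fun hb => ?_)
    · refine Runs.straight (by simp) (by simp) ?_
      have hxB : x ∈ s.items := by simpa [hx', h3, State.items] using hb
      refine ⟨h3, by simpa [Nat.add_mul] using Nat.le_add_right_of_le hN, fun p q => ?_⟩
      refine (hL p q).trans ⟨fun h => ⟨h.1, h.2.1, by omega⟩, fun h => ⟨h.1, h.2.1, ?_⟩⟩
      rcases Nat.lt_succ_iff_lt_or_eq.1 h.2.2 with h' | rfl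
      · exact h'
      · exact absurd hxB h.1.2.1
    · have hxB : s.arr 3 x = 0 := by simpa [hx', h3] using hb
      refine Runs.mono (Runs.forLoop t (38 + Q) (fun y s' =>
        s'.arr 3 = s.arr 3 ∧ s'.reg 6 ≤ x * t + y ∧ ∀ p q, s'.Listed p q ↔
          (itemMatroid M m).Arc s.items p q ∧ p < t ∧ (p < x ∨ p = x ∧ q < y)) ?_ ?_ ?_ ?_)
          le_rfl ?_
      · simp [testPair, addArc]
      · intro s'' hf
        simpa [ht'] using hf.1 2 (by simp [testPair, addArc, forLoop])
      · refine ⟨h3, by simpa using hN, fun p q => ?_⟩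
        simpa [State.Listed] using hL p q
      · rintro y s'' hy ⟨h3', hN', hL'⟩ hy' hf'
        have hx'' : s''.reg 9 = x :=
          (hf'.1 9 (by simp [testPair, addArc, forLoop])).trans hx'
        refine Runs.straight (by simp [testPair, addArc])
          (by simp [testPair, addArc]; omega) ?_
        have hskip : ¬ (itemMatroid M m).Arc s.items x y →
            ∀ p q, (s''.Listed p q ↔ (itemMatroid M m).Arc s.items p q ∧ p < t ∧
              (p < x ∨ p = x ∧ q < y + 1)) := by
          intro hno p q
          refine (hL' p q).trans (and_congr_right fun h => and_congr_right fun _ => or_congr_right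
            (and_congr_right fun hpx => ⟨fun h => by omega, fun h' => ?_⟩))
          rcases Nat.lt_succ_iff_lt_or_eq.1 h' with h' | rfl
          · exact h'
          · exact absurd (hpx ▸ h) hno
        by_cases hyB : s.arr 3 y = 0
        · have hrun : testPair.run (indepOracle M) s'' = s'' := by
            simp [testPair, hy', h3', hyB]
          rw [hrun]
          refine ⟨h3', by simp; omega, ?_⟩
          have := hskip fun h => h.2.2.1 hyB
          simpa [State.Listed] using this
        · have hxy : x ≠ y := by rintro rfl; exact hyB hxB
          have hy1 : s.arr 3 y = 1 := by have := hle y; omega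
          -- Writing back the constants `0` and `1` is correct because the array is a genuine 0/1
          -- vector.
          have hrest : Function.update (Function.update (Function.update (Function.update
              (s.arr 3) x 1) y 0) x 0) y 1 = s.arr 3 := by
            funext i
            by_cases hiy : i = y
            · simp [hiy, hy1]
            · by_cases hix : i = x <;> simp [hiy, hix, hxB, hxy]
          have hArc : (itemMatroid M m).Arc s.items x y ↔ indepOracle M (Function.update
            (Function.update (s.arr 3) x 1) y 0) := arc_iff_indepOracle hB hx hy hxB hyB
          by_cases hO : indepOracle M (Function.update (Function.update (s.arr 3) x 1) y 0)
          · simp only [testPair, addArc, Prog.run, Expr.eval, State.setReg_reg, State.setReg_arr,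
              State.setArr_reg, State.setArr_arr, hy', h3', hx'', hyB, hO, if_true, ne_eq,
              one_ne_zero, not_false_eq_true, Nat.reduceEqDiff, if_false, hrest, State.Listed,
              exists_lt_update_iff]
            refine ⟨trivial, by omega, fun p q => ?_⟩
            rw [show (∃ j < s''.reg 6, s''.arr 12 j = p ∧ s''.arr 13 j = q) ↔ _ from hL' p q]
            constructor
            · rintro (h | ⟨rfl, rfl⟩)
              · exact ⟨h.1, h.2.1, by omega⟩
              · exact ⟨hArc.2 hO, hx, by omega⟩
            · rintro ⟨h1, h2, h3⟩
              by_cases h : p = x ∧ q = y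
              · exact Or.inr h
              · exact Or.inl ⟨h1, h2, by omega⟩
          · have hno := hskip fun h => hO (hArc.1 h)
            simp only [testPair, addArc, Prog.run, Expr.eval, State.setReg_reg, State.setReg_arr,
              State.setArr_reg, State.setArr_arr, hy', h3', hx'', hyB, hO, if_true, ne_eq,
              not_true_eq_false, not_false_eq_true, Nat.reduceEqDiff, if_false, hrest,
              State.Listed]
            exact ⟨trivial, by omega, hno⟩
      · rintro s'' - ⟨⟨h3', hN', hL'⟩, -⟩
        refine ⟨by simpa using h3', by simpa [Nat.add_mul] using hN', fun p q => ?_⟩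
        have := hL' p q
        simp only [State.Listed, State.setReg_arr, State.setReg_reg, Nat.reduceEqDiff,
          if_false] at this ⊢
        refine this.trans (and_congr_right fun h => and_congr_right fun hp => ?_)
        have := hlt h hp
        omega
  · rintro s' - ⟨⟨h3, hN, hL⟩, -⟩
    exact ⟨h3, hN, fun p q => (hL p q).trans (and_congr_right fun _ => by omega)⟩

/-- Each edge contributes exactly one exchange, from its half outside the base to the one inside; no
oracle call is needed. -/
theorem runs_edgeArcs {O : (ℕ → ℕ) → Prop} {s : State} (hm : s.reg 1 = m) (ht : s.reg 2 = t)
    (hB : (itemMatroid M m).IsBase s.items)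
    (hL₀ : ∀ p q, s.Listed p q ↔ (itemMatroid M m).Arc s.items p q ∧ p < t) :
    Runs O Q edgeArcs s (80 * (m + 1)) fun s' => s'.reg 6 ≤ s.reg 6 + m ∧
      ∀ p q, s'.Listed p q ↔ (itemMatroid M m).Arc s.items p q := by
  refine Runs.mono (Runs.forLoop m 50 (fun e s' => s'.reg 6 ≤ s.reg 6 + e ∧
      ∀ p q, s'.Listed p q ↔ (itemMatroid M m).Arc s.items p q ∧
        (p < t ∨ ∃ a < e, p = t + a ∨ p = t + m + a)) ?_ ?_ ?_ ?_) ?_ ?_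
  · simp [addArc]
  · intro s' hf
    simpa [hm] using hf.1 1 (by simp [addArc, forLoop])
  · simpa [State.Listed] using hL₀
  · rintro e s' he ⟨hN, hL⟩ he' hf
    have h3 : s'.arr 3 = s.arr 3 := hf.2 3 (by simp [addArc, forLoop])
    have hm' : s'.reg 1 = m := (hf.1 1 (by simp [addArc, forLoop])).trans hm
    have ht' : s'.reg 2 = t := (hf.1 2 (by simp [addArc, forLoop])).trans ht
    refine Runs.straight (by simp [addArc]) (by simp [addArc]) ?_
    have htw : t + m + e ∈ s.items ↔ t + e ∉ s.items := (itemMatroid_isBase_iff.1 hB).2.1 e he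
    have hstep : ∀ x y, (x = t + e ∧ y = t + m + e ∨ x = t + m + e ∧ y = t + e) → x ∉ s.items →
        y ∈ s.items → ∀ p q, (s'.Listed p q ∨ (p = x ∧ q = y) ↔
          (itemMatroid M m).Arc s.items p q ∧
            (p < t ∨ ∃ a < e + 1, p = t + a ∨ p = t + m + a)) := by
      intro x y hxy hx hy p q
      rw [hL]
      constructor
      · rintro (⟨h, h' | ⟨a, ha, h'⟩⟩ | ⟨rfl, rfl⟩)
        · exact ⟨h, Or.inl h'⟩
        · exact ⟨h, Or.inr ⟨a, by omega, h'⟩⟩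
        · exact ⟨arc_twin hB he hxy hx, Or.inr ⟨e, by omega, by omega⟩⟩
      · rintro ⟨h, h' | ⟨a, ha, h'⟩⟩
        · exact Or.inl ⟨h, Or.inl h'⟩
        · by_cases hae : a = e
          · subst hae
            right
            have hp : p ∉ s.items := h.2.1
            have hpx : p = x := by
              rcases hxy with ⟨rfl, rfl⟩ | ⟨rfl, rfl⟩ <;> rcases h' with rfl | rfl
              · rfl
              · exact absurd hy hp
              · exact absurd hy hp
              · rfl
            refine ⟨hpx, ?_⟩
            rcases (arc_iff hB).1 h with h | ⟨b, hb, h, -⟩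
            · omega
            · omega
          · exact Or.inl ⟨h, Or.inr ⟨a, by omega, h'⟩⟩
    by_cases hb : s.arr 3 (t + e) = 0
    · have h1 : t + e ∉ s.items := by simp [State.items, hb]
      simp only [addArc, Prog.run, Expr.eval, State.setReg_reg, State.setReg_arr,
        State.setArr_reg, State.setArr_arr, he', h3, hm', ht', hb, if_true, ne_eq,
        not_true_eq_false, Nat.reduceEqDiff, if_false, State.Listed,
        exists_lt_update_iff]
      exact ⟨by omega, hstep _ _ (Or.inl ⟨rfl, rfl⟩) h1 (htw.2 h1)⟩
    · have h1 : t + e ∈ s.items := hb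
      simp only [addArc, Prog.run, Expr.eval, State.setReg_reg, State.setReg_arr,
        State.setArr_reg, State.setArr_arr, he', h3, hm', ht', hb, if_true, ne_eq,
        not_false_eq_true, Nat.reduceEqDiff, if_false, State.Listed,
        exists_lt_update_iff]
      exact ⟨by omega, hstep _ _ (Or.inr ⟨rfl, rfl⟩) (fun h => htw.1 h h1) h1⟩
  · simp only [Expr.cost]
    omega
  · rintro s' - ⟨⟨hN, hL⟩, -⟩
    refine ⟨hN, fun p q => (hL p q).trans ⟨fun h => h.1, fun h => ⟨h, ?_⟩⟩⟩
    rcases (arc_iff hB).1 h with h | ⟨e, he, h, -⟩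
    · exact Or.inl h.1
    · exact Or.inr ⟨e, he, by omega⟩

end OracleRAM

/-! ### Search trees and linked lists -/

/-- A breadth-first search tree for the digraph with the arcs `src j → dst j`, `j < N`: the vertices
reachable from `v₀` are `qu 0, …, qu (L - 1)`, and `qu b` was found through the arc `pa b` when
`qu (par b)` was processed. -/
structure SearchTree (N : ℕ) (src dst : ℕ → ℕ) (v₀ L : ℕ) (qu par pa : ℕ → ℕ) : Prop where
  pos : 0 < L
  root : qu 0 = v₀
  inj : ∀ a < L, ∀ b < L, qu a = qu b → a = b
  par_lt : ∀ b < L, 0 < b → par b < b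
  arc : ∀ b < L, 0 < b → pa b < N ∧ src (pa b) = qu (par b) ∧ dst (pa b) = qu b
  first : ∀ b < L, 0 < b → ∀ a < par b, ∀ j < N, src j = qu a → dst j ≠ qu b

theorem SearchTree.start (N : ℕ) (src dst : ℕ → ℕ) {v₀ : ℕ} {qu par pa : ℕ → ℕ}
    (h : qu 0 = v₀) : SearchTree N src dst v₀ 1 qu par pa where
  pos := one_pos
  root := h
  inj := by intros; omega
  par_lt := by intros; omega
  arc := by intros; omega
  first := by intros; omega

/-- Adding a newly found vertex to a search tree. -/
theorem SearchTree.extend {N : ℕ} {src dst : ℕ → ℕ} {v₀ L : ℕ} {qu par pa : ℕ → ℕ}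
    (H : SearchTree N src dst v₀ L qu par pa) {h j : ℕ} (hh : h < L) (hj : j < N)
    (hsrc : src j = qu h) (hnew : ∀ b < L, qu b ≠ dst j)
    (hclosed : ∀ a < h, ∀ j < N, src j = qu a → ∃ b < L, qu b = dst j) :
    SearchTree N src dst v₀ (L + 1) (Function.update qu L (dst j)) (Function.update par L h)
      (Function.update pa L j) where
  pos := by omega
  root := by rw [Function.update_of_ne (by omega), H.root]
  inj := by
    intro a ha b hb hab
    by_cases haL : a = L <;> by_cases hbL : b = L
    · omega
    · subst haL
      rw [Function.update_self, Function.update_of_ne hbL] at hab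
      exact absurd hab.symm (hnew b (by omega))
    · subst hbL
      rw [Function.update_self, Function.update_of_ne haL] at hab
      exact absurd hab (hnew a (by omega))
    · rw [Function.update_of_ne haL, Function.update_of_ne hbL] at hab
      exact H.inj a (by omega) b (by omega) hab
  par_lt := by
    intro b hb h0
    by_cases hbL : b = L
    · subst hbL
      rwa [Function.update_self]
    · rw [Function.update_of_ne hbL]
      exact H.par_lt b (by omega) h0
  arc := by
    intro b hb h0
    by_cases hbL : b = L
    · subst hbL
      rw [Function.update_self, Function.update_self, Function.update_self,
        Function.update_of_ne (by omega)]
      exact ⟨hj, hsrc, rfl⟩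
    · have := H.par_lt b (by omega) h0
      rw [Function.update_of_ne hbL, Function.update_of_ne hbL, Function.update_of_ne hbL,
        Function.update_of_ne (by omega)]
      exact H.arc b (by omega) h0
  -- Vertices processed before `h` have all their heads in the old queue, and the new vertex is not
  -- there.
  first := by
    intro b hb h0 a ha i hi hia
    by_cases hbL : b = L
    · subst hbL
      rw [Function.update_self] at ha ⊢
      rw [Function.update_of_ne (by omega)] at hia
      obtain ⟨c, hc, hc'⟩ := hclosed a ha i hi hia
      exact hc' ▸ hnew c hc
    · rw [Function.update_of_ne hbL] at ha ⊢
      have := H.par_lt b (by omega) h0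
      rw [Function.update_of_ne (by omega)] at hia
      exact H.first b (by omega) h0 a ha i hi hia

/-- The pointer `p` (`0` or the successor of an entry) is the start of the linked list `l`. -/
def Chain (next : ℕ → ℕ) : ℕ → List ℕ → Prop
  | p, [] => p = 0
  | p, j :: l => p = j + 1 ∧ Chain next (next j) l

theorem Chain.update {next : ℕ → ℕ} {p : ℕ} {l : List ℕ} (h : Chain next p l) {i v : ℕ}
    (hi : i ∉ l) : Chain (Function.update next i v) p l := by
  induction l generalizing p with
  | nil => exact h
  | cons j l ih =>
    rw [List.mem_cons, not_or] at hi
    refine ⟨h.1, ?_⟩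
    rw [Function.update_of_ne (Ne.symm hi.1)]
    exact ih h.2 hi.2

namespace OracleRAM

open RootedGraph

variable {O : (ℕ → ℕ) → Prop} {n N Q : ℕ}

/-- The tail of a listed pair, as a vertex. -/
def State.src (s : State) (j : ℕ) : ℕ := s.arr 4 (s.arr 12 j)

/-- The head of a listed pair, as a vertex. -/
def State.dst (s : State) (j : ℕ) : ℕ := s.arr 4 (s.arr 13 j)

/-! ### Breadth-first search -/

/-- Initializes the search. -/
def clearSearch : Prog := forLoop 9 (.reg 0) <|
  .seq (.store 6 (.reg 9) (.const 0)) (.store 8 (.reg 9) (.const 0))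

/-- Builds linked lists of the pairs with a common tail. -/
def buildLists : Prog := forLoop 9 (.reg 6) <|
  .seq (.store 7 (.reg 9) (.get 6 (.get 4 (.get 12 (.reg 9)))))
    (.store 6 (.get 4 (.get 12 (.reg 9))) (.add (.reg 9) (.const 1)))

theorem runs_clearSearch {s : State} (hn : s.reg 0 = n) :
    Runs O Q clearSearch s (20 * (n + 1)) fun s' =>
      (∀ v < n, s'.arr 6 v = 0) ∧ ∀ v < n, s'.arr 8 v = 0 := by
  refine Runs.mono (Runs.forLoop n 6 (fun j s' =>
    (∀ v < j, s'.arr 6 v = 0) ∧ ∀ v < j, s'.arr 8 v = 0) ?_ ?_ ?_ ?_) ?_ ?_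
  · simp
  · intro s' hf
    simpa [hn] using hf.1 0 (by simp [forLoop])
  · simp
  · rintro j s' hj ⟨h1, h2⟩ hj' -
    refine Runs.straight (by simp) (by simp) ?_
    simp only [Prog.run, Expr.eval, State.setArr_arr, State.setArr_reg, State.setReg_arr, if_true,
      hj', Function.update_apply, Nat.reduceEqDiff, if_false]
    refine ⟨fun v hv => ?_, fun v hv => ?_⟩
    · split_ifs
      · rfl
      · exact h1 v (by omega)
    · split_ifs
      · rfl
      · exact h2 v (by omega)
  · simp only [Expr.cost]
    omega
  · rintro s' - ⟨h, -⟩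
    exact h

/-- `l` is the linked list of all pairs among the first `N` with tail `v`. -/
def State.IsArcList (s : State) (N v : ℕ) (l : List ℕ) : Prop :=
  Chain (s.arr 7) (s.arr 6 v) l ∧ l.Nodup ∧ ∀ j, j ∈ l ↔ j < N ∧ s.src j = v

/-- Each pair is prepended to the list of its tail. Pointers are indices shifted by one, so the
cleared value `0` means the empty list. -/
theorem runs_buildLists {s : State} (hN : s.reg 6 = N) (h0 : ∀ v < n, s.arr 6 v = 0) :
    Runs O Q buildLists s (30 * (N + 1)) fun s' => ∀ v < n, ∃ l, s'.IsArcList N v l := by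
  refine Runs.mono (Runs.forLoop N 15 (fun j s' => ∀ v < n, ∃ l, s'.IsArcList j v l)
    ?_ ?_ ?_ ?_) ?_ ?_
  · simp
  · intro s' hf
    simpa [hN] using hf.1 6 (by simp [forLoop])
  · intro v hv
    exact ⟨[], by simp [Chain, h0 v hv], List.nodup_nil, by simp⟩
  · rintro i s' hi hI hi' -
    refine Runs.straight (by simp) (by simp) ?_
    intro v hv
    obtain ⟨l, h1, h2, h3⟩ := hI v hv
    have hil : i ∉ l := fun h => by
      have := (h3 i).1 h
      omega
    by_cases hvi : s'.src i = v
    · refine ⟨i :: l, ?_, List.nodup_cons.2 ⟨hil, h2⟩, fun j => ?_⟩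
      · simp only [Prog.run, Expr.eval, State.setArr_arr, State.setArr_reg, State.setReg_arr,
          if_true, hi', Nat.reduceEqDiff, if_false]
        refine ⟨?_, ?_⟩
        · rw [show s'.arr 4 (s'.arr 12 i) = v from hvi, Function.update_self]
        · rw [Function.update_self, show s'.arr 4 (s'.arr 12 i) = v from hvi]
          exact h1.update hil
      · have : State.src (State.setReg (Prog.run O (.seq (.store 7 (.reg 9)
          (.get 6 (.get 4 (.get 12 (.reg 9))))) (.store 6 (.get 4 (.get 12 (.reg 9)))
            (.add (.reg 9) (.const 1)))) s') 9 (i + 1)) = s'.src := by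
          funext a
          simp [State.src]
        rw [this, List.mem_cons, h3]
        constructor
        · rintro (rfl | h)
          · exact ⟨by omega, hvi⟩
          · exact ⟨by omega, h.2⟩
        · rintro ⟨h, h'⟩
          by_cases hji : j = i
          · exact Or.inl hji
          · exact Or.inr ⟨by omega, h'⟩
    · refine ⟨l, ?_, h2, fun j => ?_⟩
      · simp only [Prog.run, Expr.eval, State.setArr_arr, State.setArr_reg, State.setReg_arr,
          if_true, hi', Nat.reduceEqDiff, if_false]
        rw [Function.update_of_ne (show v ≠ s'.arr 4 (s'.arr 12 i) from fun h => hvi h.symm)]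
        exact h1.update hil
      · have : State.src (State.setReg (Prog.run O (.seq (.store 7 (.reg 9)
          (.get 6 (.get 4 (.get 12 (.reg 9))))) (.store 6 (.get 4 (.get 12 (.reg 9)))
            (.add (.reg 9) (.const 1)))) s') 9 (i + 1)) = s'.src := by
          funext a
          simp [State.src]
        rw [this, h3]
        constructor
        · rintro ⟨h, h'⟩
          exact ⟨by omega, h'⟩
        · rintro ⟨h, h'⟩
          refine ⟨?_, h'⟩
          by_contra hji
          exact hvi (by rwa [show i = j by omega])
  · simp only [Expr.cost]
    omega
  · rintro s' - ⟨h, -⟩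
    exact h

/-- One step of the search: processes the pair in register `13`, or goes on to the next vertex. -/
def searchStep : Prog := .ite (.eq (.reg 13) (.const 0))
  (.seq (.assign 11 (.add (.reg 11) (.const 1))) (.assign 13 (.get 6 (.get 9 (.reg 11)))))
  (.seq (.assign 14 (.get 4 (.get 13 (.sub (.reg 13) (.const 1))))) <|
    .seq (.ite (.get 8 (.reg 14)) .skip <|
      .seq (.store 8 (.reg 14) (.const 1)) <| .seq (.store 9 (.reg 12) (.reg 14)) <|
      .seq (.store 10 (.reg 12) (.reg 11)) <|
      .seq (.store 11 (.reg 12) (.sub (.reg 13) (.const 1)))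
        (.assign 12 (.add (.reg 12) (.const 1))))
      (.assign 13 (.get 7 (.sub (.reg 13) (.const 1)))))

/-- Breadth-first search from the vertex in register `8`. -/
def searchLoop : Prog := .seq (.store 8 (.reg 8) (.const 1)) <|
  .seq (.store 9 (.const 0) (.reg 8)) <| .seq (.assign 11 (.const 0)) <|
  .seq (.assign 12 (.const 1)) <| .seq (.assign 13 (.get 6 (.reg 8))) <|
  .while (.lt (.reg 11) (.reg 12)) searchStep

open Classical in
/-- The pairs that have been processed when `h` vertices and the pairs not in `rem` with tail `qu h`
have been processed. -/
def processed (N : ℕ) (src qu : ℕ → ℕ) (h : ℕ) (rem : List ℕ) : Finset ℕ :=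
  (Finset.range N).filter fun j => (∃ a < h, src j = qu a) ∨ (src j = qu h ∧ j ∉ rem)

theorem card_processed_le (N : ℕ) (src qu : ℕ → ℕ) (h : ℕ) (rem : List ℕ) :
    (processed N src qu h rem).card ≤ N :=
  (Finset.card_filter_le _ _).trans (Finset.card_range N).le

/-- The invariant of the search loop. -/
structure SearchInv (n N : ℕ) (src dst : ℕ → ℕ) (v₀ : ℕ) (first next : ℕ → ℕ) (c : ℕ) (s : State) :
    Prop where
  tree : SearchTree N src dst v₀ (s.reg 12) (s.arr 9) (s.arr 10) (s.arr 11)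
  lt : ∀ b < s.reg 12, s.arr 9 b < n
  vis : ∀ w < n, s.arr 8 w ≠ 0 ↔ ∃ b < s.reg 12, s.arr 9 b = w
  head_le : s.reg 11 ≤ s.reg 12
  closed : ∀ a < s.reg 11, ∀ j < N, src j = s.arr 9 a → ∃ b < s.reg 12, s.arr 9 b = dst j
  cur : s.reg 11 < s.reg 12 → ∃ rem, Chain next (s.reg 13) rem ∧ rem.Nodup ∧
    (∀ j ∈ rem, j < N ∧ src j = s.arr 9 (s.reg 11)) ∧
    (∀ j < N, src j = s.arr 9 (s.reg 11) → j ∉ rem → ∃ b < s.reg 12, s.arr 9 b = dst j) ∧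
    60 * ((n - s.reg 11) + (N - (processed N src (s.arr 9) (s.reg 11) rem).card)) ≤ c

end OracleRAM

/-- Pigeonhole for the distinct queue entries. It ensures that the term `n - s.reg 11` of the search
potential drops whenever the head advances. -/
theorem SearchTree.le_of_lt {N : ℕ} {src dst : ℕ → ℕ} {v₀ L n : ℕ} {qu par pa : ℕ → ℕ}
    (H : SearchTree N src dst v₀ L qu par pa) (h : ∀ b < L, qu b < n) : L ≤ n := by
  have := Finset.card_le_card_of_injOn (s := Finset.range L) (t := Finset.range n) qu
    (fun b hb => by simpa using h b (by simpa using hb))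
    (fun a ha b hb hab => H.inj a (by simpa using ha) b (by simpa using hb) hab)
  simpa using this

namespace OracleRAM

open RootedGraph

variable {O : (ℕ → ℕ) → Prop} {n N Q : ℕ}

theorem processed_congr {N : ℕ} {src qu qu' : ℕ → ℕ} {h : ℕ} {rem : List ℕ}
    (hq : ∀ a ≤ h, qu' a = qu a) : processed N src qu' h rem = processed N src qu h rem := by
  unfold processed
  refine Finset.filter_congr fun j _ => ?_
  rw [hq h le_rfl]
  refine or_congr_left ⟨?_, ?_⟩
  · rintro ⟨a, ha, h'⟩
    exact ⟨a, ha, hq a ha.le ▸ h'⟩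
  · rintro ⟨a, ha, h'⟩
    exact ⟨a, ha, (hq a ha.le).symm ▸ h'⟩

/-- Queue entries are distinct, so `j` cannot have been counted through an earlier one; removing it
from the remaining list adds it to the count. -/
theorem card_processed_lt {N : ℕ} {src qu : ℕ → ℕ} {h j : ℕ} {rem : List ℕ} (hj : j < N)
    (hsrc : src j = qu h) (hrem : j ∉ rem) (hq : ∀ a < h, qu a ≠ qu h) :
    (processed N src qu h (j :: rem)).card < (processed N src qu h rem).card := by
  unfold processed
  refine Finset.card_lt_card ⟨?_, fun hsub => ?_⟩
  · intro i hi
    rw [Finset.mem_filter, List.mem_cons] at hi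
    rw [Finset.mem_filter]
    exact ⟨hi.1, hi.2.imp_right fun h => ⟨h.1, fun h' => h.2 (Or.inr h')⟩⟩
  · have := @hsub j (by
      rw [Finset.mem_filter]
      exact ⟨Finset.mem_range.2 hj, Or.inr ⟨hsrc, hrem⟩⟩)
    rw [Finset.mem_filter] at this
    rcases this.2 with ⟨a, ha, h'⟩ | ⟨-, h'⟩
    · exact hq a ha (by rw [← h', hsrc])
    · exact h' (by simp)

theorem card_processed_succ (N : ℕ) (src qu : ℕ → ℕ) (h : ℕ) (rem : List ℕ) :
    (processed N src qu h []).card ≤ (processed N src qu (h + 1) rem).card := by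
  unfold processed
  refine Finset.card_le_card fun j hj => ?_
  rw [Finset.mem_filter] at hj ⊢
  refine ⟨hj.1, Or.inl ?_⟩
  rcases hj.2 with ⟨a, ha, h'⟩ | ⟨h', -⟩
  · exact ⟨a, by omega, h'⟩
  · exact ⟨h, by omega, h'⟩

/-- A step either advances the head of the queue or processes one pair. Each lowers the potential in
`SearchInv.cur` by at least 60, enough for the `3 + 1 + 45` units of test and body. -/
theorem runs_searchStep {src dst first next : ℕ → ℕ} {v₀ c : ℕ} {s : State}
    (hlist : ∀ v < n, ∃ l, Chain next (first v) l ∧ l.Nodup ∧ ∀ j, j ∈ l ↔ j < N ∧ src j = v)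
    (hdst : ∀ j < N, dst j < n) (h6 : s.arr 6 = first) (h7 : s.arr 7 = next)
    (hd : ∀ j, s.arr 4 (s.arr 13 j) = dst j)
    (H : SearchInv n N src dst v₀ first next c s) (hlt : s.reg 11 < s.reg 12) :
    Runs O Q searchStep s 45 fun s' =>
      ∃ c', SearchInv n N src dst v₀ first next c' s' ∧ 3 + 1 + 45 + c' ≤ c := by
  obtain ⟨rem, hch, hnd, hrem, hproc, hc⟩ := H.cur hlt
  have hLn : s.reg 12 ≤ n := H.tree.le_of_lt H.lt
  refine Runs.straight (by simp [searchStep]) (by simp [searchStep]) ?_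
  cases rem with
  | nil =>
    have h13 : s.reg 13 = 0 := hch
    have hclosed : ∀ a < s.reg 11 + 1, ∀ j < N, src j = s.arr 9 a →
        ∃ b < s.reg 12, s.arr 9 b = dst j := by
      intro a ha j hj hja
      by_cases h : a = s.reg 11
      · subst h
        exact hproc j hj hja (by simp)
      · exact H.closed a (by omega) j hj hja
    simp only [searchStep, Prog.run, Expr.eval, h13, if_true, ne_eq, one_ne_zero,
      not_false_eq_true]
    refine ⟨60 * ((n - (s.reg 11 + 1)) + (N - (processed N src (s.arr 9) (s.reg 11) []).card)),
      ⟨?_, ?_, ?_, ?_, ?_, ?_⟩, by omega⟩ <;>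
      simp only [State.setReg_reg, State.setReg_arr, Nat.reduceEqDiff, if_false, if_true]
    · exact H.tree
    · exact H.lt
    · exact H.vis
    · omega
    · exact hclosed
    · intro hlt'
      obtain ⟨l, hl1, hl2, hl3⟩ := hlist _ (H.lt _ hlt')
      refine ⟨l, by rwa [h6], hl2, fun j hj => (hl3 j).1 hj,
        fun j hj hs hjl => absurd ((hl3 j).2 ⟨hj, hs⟩) hjl, ?_⟩
      have := card_processed_succ N src (s.arr 9) (s.reg 11) l
      omega
  | cons j rem =>
    have h13 : s.reg 13 = j + 1 := hch.1
    have hnext : Chain next (next j) rem := hch.2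
    obtain ⟨hjN, hsrc⟩ := hrem j (by simp)
    rw [List.nodup_cons] at hnd
    have hlt' := card_processed_lt hjN hsrc hnd.1
      (fun a ha h => by have := H.tree.inj a (by omega) _ hlt h; omega)
    have hle := card_processed_le N src (s.arr 9) (s.reg 11) rem
    by_cases hv : s.arr 8 (dst j) = 0
    · have hnew : ∀ b < s.reg 12, s.arr 9 b ≠ dst j := fun b hb h =>
        (H.vis _ (hdst j hjN)).2 ⟨b, hb, h⟩ hv
      simp only [searchStep, Prog.run, Expr.eval, h13, if_false, ne_eq, not_true_eq_false,
        Nat.add_one_ne_zero, State.setReg_reg, State.setReg_arr, State.setArr_reg,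
        State.setArr_arr, Nat.reduceEqDiff, if_true, Nat.add_sub_cancel, hd, hv]
      have hold : ∀ b < s.reg 12, Function.update (s.arr 9) (s.reg 12) (dst j) b = s.arr 9 b :=
        fun b hb => Function.update_of_ne (by omega) _ _
      have hmono : ∀ w, (∃ b < s.reg 12, s.arr 9 b = w) → ∃ b < s.reg 12 + 1,
          Function.update (s.arr 9) (s.reg 12) (dst j) b = w := by
        rintro w ⟨b, hb, rfl⟩
        exact ⟨b, by omega, hold b hb⟩
      refine ⟨60 * ((n - s.reg 11) + (N - (processed N src (s.arr 9) (s.reg 11) rem).card)),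
        ⟨?_, ?_, ?_, ?_, ?_, ?_⟩, by omega⟩ <;>
        simp only [State.setReg_reg, State.setReg_arr, State.setArr_reg, State.setArr_arr,
          Nat.reduceEqDiff, if_false, if_true]
      · exact H.tree.extend hlt hjN hsrc hnew H.closed
      · intro b hb
        by_cases hbL : b = s.reg 12
        · rw [hbL, Function.update_self]
          exact hdst j hjN
        · rw [hold b (by omega)]
          exact H.lt b (by omega)
      · intro w hw
        by_cases hwj : w = dst j
        · subst hwj
          simp only [Function.update_self, ne_eq, one_ne_zero, not_false_eq_true, true_iff]
          exact ⟨s.reg 12, by omega, by rw [Function.update_self]⟩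
        · rw [Function.update_of_ne hwj, H.vis w hw]
          refine ⟨hmono w, ?_⟩
          rintro ⟨b, hb, h⟩
          by_cases hbL : b = s.reg 12
          · rw [hbL, Function.update_self] at h
            exact absurd h.symm hwj
          · exact ⟨b, by omega, by rw [← h, hold b (by omega)]⟩
      · omega
      · intro a ha i hi hia
        rw [hold a (by omega)] at hia
        exact hmono _ (H.closed a ha i hi hia)
      · intro _
        refine ⟨rem, by rwa [h7], hnd.2, ?_, ?_, ?_⟩
        · intro i hi
          rw [hold _ hlt]
          exact hrem i (by simp [hi])
        · intro i hi hs hir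
          rw [hold _ hlt] at hs
          by_cases hij : i = j
          · subst hij
            exact ⟨s.reg 12, by omega, by rw [Function.update_self]⟩
          · exact hmono _ (hproc i hi hs (by simp [hij, hir]))
        · rw [processed_congr (qu := s.arr 9) fun a ha => hold a (by omega)]
    · simp only [searchStep, Prog.run, Expr.eval, h13, if_false, ne_eq, not_true_eq_false,
        not_false_eq_true,
        Nat.add_one_ne_zero, State.setReg_reg, State.setReg_arr, State.setArr_reg,
        Nat.reduceEqDiff, if_true, Nat.add_sub_cancel, hd, hv]
      refine ⟨60 * ((n - s.reg 11) + (N - (processed N src (s.arr 9) (s.reg 11) rem).card)),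
        ⟨?_, ?_, ?_, ?_, ?_, ?_⟩, by omega⟩ <;>
        simp only [State.setReg_reg, State.setReg_arr, Nat.reduceEqDiff, if_false, if_true]
      · exact H.tree
      · exact H.lt
      · exact H.vis
      · exact H.head_le
      · exact H.closed
      · intro _
        refine ⟨rem, by rwa [h7], hnd.2, fun i hi => hrem i (by simp [hi]), ?_, le_rfl⟩
        intro i hi hs hir
        by_cases hij : i = j
        · subst hij
          exact (H.vis _ (hdst i hjN)).1 hv
        · exact hproc i hi hs (by simp [hij, hir])

/-- The search finds all vertices reachable from `v₀`. -/
theorem runs_searchLoop {s : State} {v₀ : ℕ} (hv : s.reg 8 = v₀) (hv₀ : v₀ < n)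
    (hlist : ∀ v < n, ∃ l, s.IsArcList N v l) (hvis : ∀ v < n, s.arr 8 v = 0)
    (hdst : ∀ j < N, s.dst j < n) :
    Runs O Q searchLoop s (60 * (n + N + 1)) fun s' =>
      SearchTree N s.src s.dst v₀ (s'.reg 12) (s'.arr 9) (s'.arr 10) (s'.arr 11) ∧
      (∀ b < s'.reg 12, s'.arr 9 b < n) ∧
      ∀ a < s'.reg 12, ∀ j < N, s.src j = s'.arr 9 a → ∃ b < s'.reg 12, s'.arr 9 b = s.dst j := by
  have hcost : 3 + (3 + (2 + (2 + (3 + (60 * (n + N) + 3 + 1))))) ≤ 60 * (n + N + 1) := by omega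
  refine Runs.mono (T := 3 + (3 + (2 + (2 + (3 + (60 * (n + N) + 3 + 1)))))) ?_ hcost
    fun _ _ h => h
  refine Runs.seq ⟨_, _, Exec.store _ _ _ _, by simp, rfl⟩ ?_
  rintro _ - rfl
  refine Runs.seq ⟨_, _, Exec.store _ _ _ _, by simp, rfl⟩ ?_
  rintro _ - rfl
  refine Runs.seq ⟨_, _, Exec.assign _ _ _, by simp, rfl⟩ ?_
  rintro _ - rfl
  refine Runs.seq ⟨_, _, Exec.assign _ _ _, by simp, rfl⟩ ?_
  rintro _ - rfl
  refine Runs.seq ⟨_, _, Exec.assign _ _ _, by simp, rfl⟩ ?_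
  rintro _ - rfl
  refine Runs.mono (Runs.while (I := fun c s' =>
    SearchInv n N s.src s.dst v₀ (s.arr 6) (s.arr 7) c s') (60 * (n + N)) _ ?_ ?_) le_rfl ?_
  · refine ⟨?_, ?_, ?_, ?_, ?_, ?_⟩ <;>
      simp only [Expr.eval, State.setReg_reg, State.setReg_arr, State.setArr_reg, State.setArr_arr,
        Nat.reduceEqDiff, if_false, if_true, hv]
    · exact SearchTree.start _ _ _ (by rw [Function.update_self])
    · intro b hb
      rw [show b = 0 by omega, Function.update_self]
      exact hv₀
    · intro w hw
      by_cases hwv : w = v₀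
      · subst hwv
        simp only [Function.update_self, ne_eq, one_ne_zero, not_false_eq_true, true_iff]
        exact ⟨0, one_pos, by rw [Function.update_self]⟩
      · rw [Function.update_of_ne hwv]
        simp only [hvis w hw, ne_eq, not_true_eq_false, false_iff]
        rintro ⟨b, hb, h⟩
        rw [show b = 0 by omega, Function.update_self] at h
        exact hwv h.symm
    · omega
    · omega
    · intro _
      obtain ⟨l, h1, h2, h3⟩ := hlist v₀ hv₀
      refine ⟨l, h1, h2, fun j hj => ?_, fun j hj hs hjl => ?_, ?_⟩
      · rw [Function.update_self]
        exact (h3 j).1 hj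
      · rw [Function.update_self] at hs
        exact absurd ((h3 j).2 ⟨hj, hs⟩) hjl
      · omega
  · intro c s' hI hf hb
    refine ⟨45, ?_⟩
    have h6 := hf.2 6 (by simp [searchStep])
    have h7 := hf.2 7 (by simp [searchStep])
    have h4 := hf.2 4 (by simp [searchStep])
    have h13 := hf.2 13 (by simp [searchStep])
    refine runs_searchStep (fun v hv => hlist v hv) hdst ?_ ?_ ?_ hI ?_
    · simpa using h6
    · simpa using h7
    · intro j
      rw [h4, h13]
      simp [State.dst]
    · by_contra h
      simp [h] at hb
  · rintro s' - ⟨⟨c, H⟩, hb⟩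
    have h12 : s'.reg 11 = s'.reg 12 := by
      have := H.head_le
      by_contra h
      have h' : s'.reg 11 < s'.reg 12 := by omega
      simp [h'] at hb
    exact ⟨H.tree, H.lt, h12 ▸ H.closed⟩

end OracleRAM

/-! ### Exchanges along a path of the search tree -/

/-- The iterates of `par` from `b` on are positive up to the `i`-th one. -/
def Alive (par : ℕ → ℕ) (b i : ℕ) : Prop := ∀ a ≤ i, 0 < par^[a] b

theorem Alive.mono {par : ℕ → ℕ} {b i j : ℕ} (h : Alive par b j) (hij : i ≤ j) : Alive par b i :=
  fun a ha => h a (ha.trans hij)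

theorem Alive.succ {par : ℕ → ℕ} {b i : ℕ} (hb : 0 < b) (h : Alive par (par b) i) :
    Alive par b (i + 1) := by
  intro a ha
  cases a with
  | zero => exact hb
  | succ a => exact h a (by omega)

/-- The exchanges along the path from `b` to the root of the search tree are possible, and none of
them can be abbreviated. -/
structure AugPath (N : Matroid ℕ) (B : Set ℕ) (par x y : ℕ → ℕ) (b : ℕ) : Prop where
  arc : ∀ i, Alive par b i → N.Arc B (x (par^[i] b)) (y (par^[i] b))
  not_arc : ∀ i j, i < j → Alive par b j → ¬ N.Arc B (x (par^[j] b)) (y (par^[i] b))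

/-- The exchange farthest from the root of the tree goes first. For every exchange nearer the root,
the fundamental circuit of the entering element avoids `y b`, since the path has no shortcut. By
`Matroid.Arc.arc_exchange_iff` the remaining exchanges stay possible and no shortcut among them
arises. -/
theorem AugPath.exchange {N : Matroid ℕ} {B : Set ℕ} {par x y : ℕ → ℕ} {b : ℕ} (hB : N.IsBase B)
    (H : AugPath N B par x y b) (hb : 0 < b) :
    AugPath N (insert (x b) (B \ {y b})) par x y (par b) := by
  have h0 : Alive par b 0 := fun a ha => by
    rw [Nat.le_zero.1 ha]
    exact hb
  have harc0 := H.arc 0 h0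
  have key : ∀ i j, i ≤ j → Alive par (par b) j →
      (N.Arc (insert (x b) (B \ {y b})) (x (par^[j] (par b))) (y (par^[i] (par b))) ↔
        N.Arc B (x (par^[j] (par b))) (y (par^[i] (par b)))) := by
    intro i j hij hj
    have hj' := hj.succ hb
    have harcj := H.arc (j + 1) hj'
    have harci := H.arc (i + 1) (hj'.mono (by omega))
    have hnj := H.not_arc 0 (j + 1) (by omega) hj'
    have hni := H.not_arc 0 (i + 1) (by omega) (hj'.mono (by omega))
    -- The elements involved are distinct: a coincidence would be a shortcut itself or would put `x
    -- b` into `B`.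
    refine Matroid.Arc.arc_exchange_iff hB harc0 harcj.1 harcj.2.1 hnj ?_ ?_ ?_
    · intro h
      exact hnj (h.symm ▸ harc0 :)
    · intro h
      exact hni (h ▸ harci :)
    · intro h
      exact harc0.2.1 (h ▸ harci.2.2.1 :)
  exact ⟨fun i hi => (key i i le_rfl hi).2 (H.arc (i + 1) (hi.succ hb)),
    fun i j hij hj h => H.not_arc (i + 1) (j + 1) (by omega) (hj.succ hb)
      ((key i j hij.le hj).1 h)⟩

/-- Parents precede their children in the queue, so indices decrease along the path. -/
theorem SearchTree.alive_lt {N : ℕ} {src dst : ℕ → ℕ} {v₀ L : ℕ} {qu par pa : ℕ → ℕ}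
    (H : SearchTree N src dst v₀ L qu par pa) {b i j : ℕ} (hb : b < L) (hj : Alive par b j)
    (hij : i < j) : par^[j] b ≤ par (par^[i] b) ∧ par^[j] b < L := by
  have hL : ∀ i, Alive par b i → par^[i] b < L := by
    intro i
    induction i with
    | zero => exact fun _ => hb
    | succ i ih =>
      intro hi
      have h1 := ih (hi.mono (by omega))
      have h2 := H.par_lt _ h1 (hi i (by omega))
      rw [Function.iterate_succ_apply']
      omega
  refine ⟨?_, hL j hj⟩
  induction j with
  | zero => omega
  | succ j ih =>
    rw [Function.iterate_succ_apply']
    rcases Nat.lt_succ_iff_lt_or_eq.1 hij with h | rfl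
    · have hj' := hj.mono (Nat.le_succ j)
      have h1 := ih hj' h
      have h2 := H.par_lt _ (hL j hj') (hj j (by omega))
      omega
    · exact le_rfl

/-- Paths in a breadth-first search tree can be used for augmentation. -/
theorem SearchTree.augPath {M : Matroid ℕ} {B : Set ℕ} {N : ℕ} {loc ax ay : ℕ → ℕ} {v₀ L : ℕ}
    {qu par pa : ℕ → ℕ} (hL : ∀ p q, (∃ j < N, ax j = p ∧ ay j = q) ↔ M.Arc B p q)
    (H : SearchTree N (fun j => loc (ax j)) (fun j => loc (ay j)) v₀ L qu par pa) {b : ℕ}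
    (hb : b < L) : AugPath M B par (fun b => ax (pa b)) (fun b => ay (pa b)) b := by
  have hlt : ∀ i, Alive par b i → par^[i] b < L := by
    intro i hi
    cases i with
    | zero => exact hb
    | succ i => exact (H.alive_lt hb hi (Nat.lt_succ_self i)).2
  refine ⟨fun i hi => (hL _ _).1 ⟨_, (H.arc _ (hlt i hi) (hi i le_rfl)).1, rfl, rfl⟩, ?_⟩
  intro i j hij hj harc
  have hi := hj.mono hij.le
  obtain ⟨a, ha, h1, h2⟩ := (hL _ _).2 harc
  have hj' := H.arc _ (hlt j hj) (hj j le_rfl)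
  have hi' := H.arc _ (hlt i hi) (hi i le_rfl)
  have h3 := (H.alive_lt hb hj hij).1
  have h4 := H.par_lt _ (hlt j hj) (hj j le_rfl)
  -- The shortcut would start at a queue entry earlier than the parent of the vertex it leads to, so
  -- that vertex would have been found from there.
  exact H.first _ (hlt i hi) (hi i le_rfl) (par (par^[j] b)) (by omega) a ha
    ((congrArg loc h1).trans hj'.2.1) ((congrArg loc h2).trans hi'.2.2)

namespace OracleRAM

open RootedGraph

variable {O : (ℕ → ℕ) → Prop} {n m t k Q : ℕ} {M : Matroid (Fin t)}

/-! ### Augmentation -/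

/-- Searches the queue for a vertex other than the first one with load less than the rank. -/
def findTarget : Prog := .seq (.assign 15 (.const 1)) <|
  .while (.lt (.const 1) (.add (.lt (.reg 15) (.reg 12))
    (.sub (.const 1) (.lt (.get 5 (.get 9 (.reg 15))) (.reg 3)))))
    (.assign 15 (.add (.reg 15) (.const 1)))

/-- The test expresses a conjunction: a sum of two 0/1 values exceeds 1. Queue position 0, the
vertex to be relieved, is skipped. A round costs `13 + 1 + 4 = 18`. -/
theorem runs_findTarget {s : State} (hL : 0 < s.reg 12) :
    Runs O Q findTarget s (20 * (s.reg 12 + 1)) fun s' =>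
      0 < s'.reg 15 ∧ (∀ b, 0 < b → b < s'.reg 15 → s.reg 3 ≤ s.arr 5 (s.arr 9 b)) ∧
      (s'.reg 15 = s.reg 12 ∨ s'.reg 15 < s.reg 12 ∧ s.arr 5 (s.arr 9 (s'.reg 15)) < s.reg 3) := by
  refine Runs.mono (Runs.seq (mid := fun s' => s' = s.setReg 15 1)
    ⟨_, _, Exec.assign _ _ _, le_rfl, rfl⟩ ?_) (T := 2 + (18 * (s.reg 12 - 1) + 13 + 1))
    (by omega) fun _ _ h => h
  rintro _ - rfl
  refine Runs.mono (Runs.while (I := fun c s' => 0 < s'.reg 15 ∧ s'.reg 15 ≤ s.reg 12 ∧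
    (∀ b, 0 < b → b < s'.reg 15 → s.reg 3 ≤ s.arr 5 (s.arr 9 b)) ∧
    c = 18 * (s.reg 12 - s'.reg 15)) (18 * (s.reg 12 - 1)) _ ?_ ?_) le_rfl ?_
  · refine ⟨by simp, by simpa using Nat.succ_le_of_lt hL, ?_, by simp⟩
    intro b hb hb'
    simp only [State.setReg_reg, if_true] at hb'
    omega
  · rintro c s' ⟨h0, hle, hI, rfl⟩ hf hb
    have h12 : s'.reg 12 = s.reg 12 := by simpa using hf.1 12 (by simp)
    have h3 : s'.reg 3 = s.reg 3 := by simpa using hf.1 3 (by simp)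
    have h5 : s'.arr 5 = s.arr 5 := by simpa using hf.2 5 (by simp)
    have h9 : s'.arr 9 = s.arr 9 := by simpa using hf.2 9 (by simp)
    have hcond : s'.reg 15 < s.reg 12 ∧ s.reg 3 ≤ s.arr 5 (s.arr 9 (s'.reg 15)) := by
      simp only [Expr.eval, h12, h3, h5, h9] at hb
      by_cases h1 : s'.reg 15 < s.reg 12 <;>
        by_cases h2 : s.arr 5 (s.arr 9 (s'.reg 15)) < s.reg 3 <;>
        simp [h1, h2] at hb
      exact ⟨h1, by omega⟩
    refine ⟨4, Runs.straight (by simp) (by simp) ⟨18 * (s.reg 12 - (s'.reg 15 + 1)), ?_, ?_⟩⟩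
    · simp only [Prog.run, Expr.eval, State.setReg_reg, if_true]
      refine ⟨by omega, by omega, fun b hb hb' => ?_, trivial⟩
      by_cases h : b = s'.reg 15
      · exact h ▸ hcond.2
      · exact hI b hb (by omega)
    · simp only [Expr.cost]
      omega
  · rintro s' hf ⟨⟨c, h0, hle, hI, -⟩, hb⟩
    have h12 : s'.reg 12 = s.reg 12 := by simpa using hf.1 12 (by simp)
    have h3 : s'.reg 3 = s.reg 3 := by simpa using hf.1 3 (by simp)
    have h5 : s'.arr 5 = s.arr 5 := by simpa using hf.2 5 (by simp)
    have h9 : s'.arr 9 = s.arr 9 := by simpa using hf.2 9 (by simp)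
    refine ⟨h0, hI, ?_⟩
    simp only [Expr.eval, h12, h3, h5, h9] at hb
    by_cases h1 : s'.reg 15 < s.reg 12 <;>
      by_cases h2 : s.arr 5 (s.arr 9 (s'.reg 15)) < s.reg 3 <;>
      simp [h1, h2] at hb
    · exact Or.inr ⟨h1, h2⟩
    · exact Or.inl (by omega)
    · exact Or.inl (by omega)

/-- Performs the exchange that led to the vertex in register `15`. -/
def augmentStep : Prog := .seq (.assign 18 (.get 11 (.reg 15))) <|
  .seq (.store 5 (.get 4 (.get 13 (.reg 18))) (.add (.get 5 (.get 4 (.get 13 (.reg 18))))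
    (.const 1))) <|
  .seq (.store 5 (.get 4 (.get 12 (.reg 18))) (.sub (.get 5 (.get 4 (.get 12 (.reg 18))))
    (.const 1))) <|
  .seq (.store 3 (.get 12 (.reg 18)) (.const 1)) <|
  .seq (.store 3 (.get 13 (.reg 18)) (.const 0)) <|
  .assign 15 (.get 10 (.reg 15))

/-- Performs all exchanges on the path to the vertex in register `15`. -/
def augment : Prog := .while (.reg 15) augmentStep

/-- The selected items form a base, and the loads are stored in array `5`. -/
structure State.Valid (M : Matroid (Fin t)) (m : ℕ) (s : State) : Prop where
  base : (itemMatroid M m).IsBase s.items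
  le_one : ∀ i, s.arr 3 i ≤ 1
  load_eq : ∀ v, s.arr 5 v = load (t + m + m) (s.arr 4) s.items v

/-- The head gains before the tail loses, so both may be the same vertex. The subtraction is exact
because `x`, being outside the base, is counted in the load of its vertex. -/
theorem runs_augmentStep {s : State} (hV : s.Valid M m) {x y : ℕ}
    (hx : s.arr 12 (s.arr 11 (s.reg 15)) = x) (hy : s.arr 13 (s.arr 11 (s.reg 15)) = y)
    (harc : (itemMatroid M m).Arc s.items x y) :
    Runs O Q augmentStep s 40 fun s' => s'.Valid M m ∧ s'.reg 15 = s.arr 10 (s.reg 15) ∧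
      s'.items = insert x (s.items \ {y}) ∧
      ∀ v, s'.arr 5 v + (if s.arr 4 x = v then 1 else 0) =
        s.arr 5 v + (if s.arr 4 y = v then 1 else 0) := by
  refine Runs.straight (by simp [augmentStep]) (by simp [augmentStep]) ?_
  have hxy : x ≠ y := by rintro rfl; exact harc.2.1 harc.2.2.1
  have hitems : {i | Function.update (Function.update (s.arr 3) x 1) y 0 i ≠ 0} =
      insert x (s.items \ {y}) := by
    ext i
    by_cases hiy : i = y
    · simp [hiy, hxy.symm]
    · by_cases hix : i = x <;> simp [hiy, hix, hxy, State.items]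
  have hxg : x < t + m + m := harc.1
  have hyg : y < t + m + m := (itemMatroid_isBase_iff.1 hV.base).2.2 y harc.2.2.1
  have hload := load_exchange (loc := s.arr 4) hxg hyg harc.2.1 harc.2.2.1
  have h5 : ∀ v, Function.update (Function.update (s.arr 5) (s.arr 4 y) (s.arr 5 (s.arr 4 y) + 1))
      (s.arr 4 x) (Function.update (s.arr 5) (s.arr 4 y) (s.arr 5 (s.arr 4 y) + 1) (s.arr 4 x) - 1)
        v = load (t + m + m) (s.arr 4) (insert x (s.items \ {y})) v := by
    intro v
    have h := hload v
    rw [← hV.load_eq] at h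
    by_cases hvx : s.arr 4 x = v <;> by_cases hvy : s.arr 4 y = v
    · subst hvx
      simp only [hvy, if_true, Function.update_self] at h ⊢
      omega
    · subst hvx
      simp only [Ne.symm hvy, hvy, if_true, if_false, Function.update_self, ne_eq,
        not_false_eq_true, Function.update_of_ne] at h ⊢
      omega
    · subst hvy
      simp only [Ne.symm hvx, hvx, if_true, if_false, Function.update_self, ne_eq,
        not_false_eq_true, Function.update_of_ne] at h ⊢
      omega
    · simp only [Ne.symm hvx, Ne.symm hvy, hvx, hvy, if_false, ne_eq, not_false_eq_true,
        Function.update_of_ne] at h ⊢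
      omega
  simp only [augmentStep, Prog.run, Expr.eval, State.setReg_reg, State.setReg_arr, State.setArr_reg,
    State.setArr_arr, Nat.reduceEqDiff, if_true, if_false, hx, hy]
  refine ⟨⟨?_, ?_, ?_⟩, trivial, ?_, ?_⟩ <;>
    simp only [State.items, State.setReg_arr, State.setArr_arr, Nat.reduceEqDiff, if_true, if_false, hitems, h5]
  · exact harc.isBase hV.base
  · intro i
    have := hV.le_one i
    simp only [Function.update_apply]
    split_ifs <;> omega
  · intro v
    trivial
  · intro v
    rw [hV.load_eq]
    exact hload v

/-- The load changes telescope: midway the target has gained its unit and the vertex at the current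
queue position has lost one. The budget is proportional to register 15, which decreases because
parents have smaller indices. -/
theorem runs_augment {s : State} {N v₀ L : ℕ} (hV : s.Valid M m)
    (hL : ∀ p q, (∃ j < N, s.arr 12 j = p ∧ s.arr 13 j = q) ↔ (itemMatroid M m).Arc s.items p q)
    (H : SearchTree N s.src s.dst v₀ L (s.arr 9) (s.arr 10) (s.arr 11)) (hb : s.reg 15 < L) :
    Runs O Q augment s (50 * (L + 1)) fun s' => s'.Valid M m ∧
      ∀ v, s'.arr 5 v + (if v₀ = v then 1 else 0) =
        s.arr 5 v + (if s.arr 9 (s.reg 15) = v then 1 else 0) := by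
  refine Runs.mono (Runs.while (I := fun c s' => s'.Valid M m ∧ s'.reg 15 < L ∧
    AugPath (itemMatroid M m) s'.items (s.arr 10) (fun b => s.arr 12 (s.arr 11 b))
      (fun b => s.arr 13 (s.arr 11 b)) (s'.reg 15) ∧
    (∀ v, s'.arr 5 v + (if s.arr 9 (s'.reg 15) = v then 1 else 0) =
      s.arr 5 v + (if s.arr 9 (s.reg 15) = v then 1 else 0)) ∧
    c = 50 * s'.reg 15) (50 * s.reg 15) _
    ⟨hV, hb, H.augPath hL hb, fun _ => rfl, rfl⟩ ?_) ?_ ?_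
  · rintro c s' ⟨hV', hb', hA, hq, rfl⟩ hf h15
    have h15' : 0 < s'.reg 15 := Nat.pos_of_ne_zero h15
    have h12 : s'.arr 12 = s.arr 12 := hf.2 12 (by simp [augmentStep])
    have h13 : s'.arr 13 = s.arr 13 := hf.2 13 (by simp [augmentStep])
    have h11 : s'.arr 11 = s.arr 11 := hf.2 11 (by simp [augmentStep])
    have h10 : s'.arr 10 = s.arr 10 := hf.2 10 (by simp [augmentStep])
    have h4 : s'.arr 4 = s.arr 4 := hf.2 4 (by simp [augmentStep])
    have harc : (itemMatroid M m).Arc s'.items (s.arr 12 (s.arr 11 (s'.reg 15)))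
        (s.arr 13 (s.arr 11 (s'.reg 15))) := hA.arc 0 fun a ha => by
      rw [Nat.le_zero.1 ha]
      exact h15'
    obtain ⟨h1, h2, h3⟩ := H.arc _ hb' h15'
    have h5 := H.par_lt _ hb' h15'
    refine ⟨40, (runs_augmentStep hV' (by rw [h12, h11]) (by rw [h13, h11]) harc).mono le_rfl ?_⟩
    rintro s'' - ⟨hV'', hb'', hi, hq'⟩
    rw [h10] at hb''
    refine ⟨50 * s''.reg 15, ⟨hV'', by omega, ?_, fun v => ?_, rfl⟩, ?_⟩
    · rw [hi, hb'']
      exact hA.exchange hV'.base h15'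
    · rw [← hq v, hb'', ← h2, ← h3, State.src, State.dst, ← h4]
      exact hq' v
    · rw [hb'']
      simp only [Expr.cost]
      omega
  · simp only [Expr.cost]
    omega
  · rintro s' - ⟨⟨c, hV', -, -, hq, -⟩, hz⟩
    refine ⟨hV', fun v => ?_⟩
    have hz' : s'.reg 15 = 0 := hz
    rw [← hq v, hz', H.root]

end OracleRAM

namespace OracleRAM

open RootedGraph

variable {n m t Q : ℕ} {M : Matroid (Fin t)} {fst snd : Fin m → Fin n} {root : Fin t → Fin n}

/-! ### The main loop -/

/-- The registers `0, …, 3` and array `4` hold the sizes, the rank and the positions. -/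
structure State.Ready (fst snd : Fin m → Fin n) (root : Fin t → Fin n) (M : Matroid (Fin t))
    (s : State) : Prop where
  reg_zero : s.reg 0 = n
  reg_one : s.reg 1 = m
  reg_two : s.reg 2 = t
  reg_three : s.reg 3 = rank M
  loc : IsLoc fst snd root (s.arr 4)

theorem State.Ready.frame {p : Prog} {s s' : State} (h : s.Ready fst snd root M)
    (hf : Frame p s s') (hr : ∀ x < 4, x ∉ p.regs) (ha : 4 ∉ p.arrs) :
    s'.Ready fst snd root M where
  reg_zero := (hf.1 0 (hr 0 (by omega))).trans h.reg_zero
  reg_one := (hf.1 1 (hr 1 (by omega))).trans h.reg_one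
  reg_two := (hf.1 2 (hr 2 (by omega))).trans h.reg_two
  reg_three := (hf.1 3 (hr 3 (by omega))).trans h.reg_three
  loc := by
    rw [hf.2 4 ha]
    exact h.loc

/-- Lists all exchanges and searches for a vertex that may take load from that in register `8`. -/
def search : Prog := .seq rootArcs <| .seq edgeArcs <| .seq clearSearch <| .seq buildLists <|
  .seq searchLoop findTarget

/-- Performs the augmentation, or rejects if there is none. -/
def augmentOrReject : Prog := .ite (.lt (.reg 15) (.reg 12)) augment
  (.seq (.assign 16 (.const 0)) (.assign 7 (.add (.reg 0) (.reg 0))))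

theorem isLoc_lt {loc : ℕ → ℕ} (h : IsLoc fst snd root loc) {i : ℕ} (hi : i < t + m + m) :
    loc i < n := by
  by_cases hit : i < t
  · exact (h.root_eq ⟨i, hit⟩) ▸ Fin.is_lt _
  · by_cases him : i < t + m
    · have := h.fst_eq ⟨i - t, by omega⟩
      simp only [show t + (i - t) = i by omega] at this
      exact this ▸ Fin.is_lt _
    · have := h.snd_eq ⟨i - t - m, by omega⟩
      simp only [show t + m + (i - t - m) = i by omega] at this
      exact this ▸ Fin.is_lt _

/-- Oracle calls occur only for pairs of roots, and the list of exchanges has at most `t * t + m`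
entries; all later phases are linear in that length and in `n`. -/
theorem runs_search {s : State} {v₀ : ℕ} (hQ : 1 ≤ Q) (hR : s.Ready fst snd root M)
    (hV : s.Valid M m) (hv : s.reg 8 = v₀) (hv₀ : v₀ < n) :
    Runs (indepOracle M) Q search s
      (100 * (t + 1) ^ 2 * Q + 170 * m + 90 * t ^ 2 + 100 * n + 300) fun s' =>
      s'.Valid M m ∧ s'.arr 5 = s.arr 5 ∧ s'.reg 12 ≤ n ∧
      (∃ N, (∀ p q, (∃ j < N, s'.arr 12 j = p ∧ s'.arr 13 j = q) ↔
          (itemMatroid M m).Arc s'.items p q) ∧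
        SearchTree N s'.src s'.dst v₀ (s'.reg 12) (s'.arr 9) (s'.arr 10) (s'.arr 11) ∧
        ∀ a < s'.reg 12, ∀ j < N, s'.src j = s'.arr 9 a → ∃ b < s'.reg 12, s'.arr 9 b = s'.dst j) ∧
      (∀ b < s'.reg 12, s'.arr 9 b < n) ∧
      0 < s'.reg 15 ∧ (∀ b, 0 < b → b < s'.reg 15 → rank M ≤ s'.arr 5 (s'.arr 9 b)) ∧
      (s'.reg 15 = s'.reg 12 ∨
        s'.reg 15 < s'.reg 12 ∧ s'.arr 5 (s'.arr 9 (s'.reg 15)) < rank M) := by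
  have hcost : 100 * (t + 1) ^ 2 * Q + (80 * (m + 1) + (20 * (n + 1) + (30 * (t * t + m + 1) +
      (60 * (n + (t * t + m) + 1) + 20 * (n + 1))))) ≤
      100 * (t + 1) ^ 2 * Q + 170 * m + 90 * t ^ 2 + 100 * n + 300 := by
    rw [show t ^ 2 = t * t by ring]
    omega
  refine Runs.mono ?_ hcost fun _ _ h => h
  refine Runs.seq (runs_rootArcs hR.reg_two hQ hV.base hV.le_one) ?_
  rintro s₁ f₁ ⟨h3, hN₁, hL₁⟩
  have hitems₁ : s₁.items = s.items := by simp only [State.items, h3]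
  have r₁ : s₁.Ready fst snd root M := hR.frame f₁
    (by simp [rootArcs, rootArcsFrom, testPair, addArc, forLoop]; omega)
    (by simp [rootArcs, rootArcsFrom, testPair, addArc, forLoop])
  refine Runs.seq (runs_edgeArcs r₁.reg_one r₁.reg_two (hitems₁ ▸ hV.base) (hitems₁ ▸ hL₁)) ?_
  rintro s₂ f₂ ⟨hN₂, hL₂⟩
  have r₂ : s₂.Ready fst snd root M := r₁.frame f₂
    (by simp [edgeArcs, addArc, forLoop]; omega) (by simp [edgeArcs, addArc, forLoop])
  refine Runs.seq (runs_clearSearch r₂.reg_zero) ?_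
  rintro s₃ f₃ ⟨h6, h8⟩
  have h63 : s₃.reg 6 = s₂.reg 6 := f₃.1 6 (by simp [clearSearch, forLoop])
  refine Runs.seq ((runs_buildLists (n := n) (N := s₂.reg 6) h63 h6).mono (by omega)
    fun _ _ h => h) ?_
  rintro s₄ f₄ hlist
  have r₄ : s₄.Ready fst snd root M := (r₂.frame f₃
    (by simp [clearSearch, forLoop]; omega) (by simp [clearSearch, forLoop])).frame f₄
    (by simp [buildLists, forLoop]; omega) (by simp [buildLists, forLoop])
  have h12 : s₄.arr 12 = s₂.arr 12 := (f₄.2 12 (by simp [buildLists, forLoop])).trans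
    (f₃.2 12 (by simp [clearSearch, forLoop]))
  have h13 : s₄.arr 13 = s₂.arr 13 := (f₄.2 13 (by simp [buildLists, forLoop])).trans
    (f₃.2 13 (by simp [clearSearch, forLoop]))
  have h34 : s₄.arr 3 = s.arr 3 := (f₄.2 3 (by simp [buildLists, forLoop])).trans <|
    (f₃.2 3 (by simp [clearSearch, forLoop])).trans <|
    (f₂.2 3 (by simp [edgeArcs, addArc, forLoop])).trans h3
  have h54 : s₄.arr 5 = s.arr 5 := (f₄.2 5 (by simp [buildLists, forLoop])).trans <|
    (f₃.2 5 (by simp [clearSearch, forLoop])).trans <|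
    (f₂.2 5 (by simp [edgeArcs, addArc, forLoop])).trans
    (f₁.2 5 (by simp [rootArcs, rootArcsFrom, testPair, addArc, forLoop]))
  have h44 : s₄.arr 4 = s.arr 4 := (f₄.2 4 (by simp [buildLists, forLoop])).trans <|
    (f₃.2 4 (by simp [clearSearch, forLoop])).trans <|
    (f₂.2 4 (by simp [edgeArcs, addArc, forLoop])).trans
    (f₁.2 4 (by simp [rootArcs, rootArcsFrom, testPair, addArc, forLoop]))
  have h84 : s₄.reg 8 = v₀ := (f₄.1 8 (by simp [buildLists, forLoop])).trans <|
    (f₃.1 8 (by simp [clearSearch, forLoop])).trans <|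
    (f₂.1 8 (by simp [edgeArcs, addArc, forLoop])).trans <|
    (f₁.1 8 (by simp [rootArcs, rootArcsFrom, testPair, addArc, forLoop])).trans hv
  have hL₄ : ∀ p q, (∃ j < s₂.reg 6, s₄.arr 12 j = p ∧ s₄.arr 13 j = q) ↔
      (itemMatroid M m).Arc s.items p q := by
    intro p q
    rw [h12, h13, ← hitems₁]
    exact hL₂ p q
  have h84' : ∀ v < n, s₄.arr 8 v = 0 := by
    rw [f₄.2 8 (by simp [buildLists, forLoop])]
    exact h8
  refine Runs.seq ((runs_searchLoop (n := n) (N := s₂.reg 6) h84 hv₀ hlist h84' ?_).mono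
    (by omega) fun _ _ h => h) ?_
  · intro j hj
    have := (hL₄ _ _).1 ⟨j, hj, rfl, rfl⟩
    exact isLoc_lt r₄.loc ((itemMatroid_isBase_iff.1 hV.base).2.2 _ this.2.2.1)
  rintro s₅ f₅ ⟨hT, hlt, hcl⟩
  have hLn : s₅.reg 12 ≤ n := hT.le_of_lt hlt
  refine (runs_findTarget hT.pos).mono (by omega) ?_
  rintro s₆ f₆ ⟨h0, hall, hfin⟩
  have e3 : s₆.arr 3 = s.arr 3 := (f₆.2 3 (by simp [findTarget])).trans
    ((f₅.2 3 (by simp [searchLoop, searchStep])).trans h34)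
  have e4 : s₆.arr 4 = s₄.arr 4 := (f₆.2 4 (by simp [findTarget])).trans
    (f₅.2 4 (by simp [searchLoop, searchStep]))
  have e5' : s₆.arr 5 = s₅.arr 5 := f₆.2 5 (by simp [findTarget])
  have e5 : s₆.arr 5 = s.arr 5 := e5'.trans
    ((f₅.2 5 (by simp [searchLoop, searchStep])).trans h54)
  have e12 : s₆.arr 12 = s₄.arr 12 := (f₆.2 12 (by simp [findTarget])).trans
    (f₅.2 12 (by simp [searchLoop, searchStep]))
  have e13 : s₆.arr 13 = s₄.arr 13 := (f₆.2 13 (by simp [findTarget])).trans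
    (f₅.2 13 (by simp [searchLoop, searchStep]))
  have e9 : s₆.arr 9 = s₅.arr 9 := f₆.2 9 (by simp [findTarget])
  have e10 : s₆.arr 10 = s₅.arr 10 := f₆.2 10 (by simp [findTarget])
  have e11 : s₆.arr 11 = s₅.arr 11 := f₆.2 11 (by simp [findTarget])
  have eL : s₆.reg 12 = s₅.reg 12 := f₆.1 12 (by simp [findTarget])
  have ek : s₅.reg 3 = rank M := (f₅.1 3 (by simp [searchLoop, searchStep])).trans r₄.reg_three
  have esrc : s₆.src = s₄.src := by
    funext j
    simp only [State.src, e4, e12]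
  have edst : s₆.dst = s₄.dst := by
    funext j
    simp only [State.dst, e4, e13]
  have eitems : s₆.items = s.items := by simp only [State.items, e3]
  rw [ek] at hall hfin
  refine ⟨⟨eitems ▸ hV.base, e3 ▸ hV.le_one, ?_⟩, e5, eL ▸ hLn, ⟨s₂.reg 6, ?_, ?_, ?_⟩, ?_, h0,
    ?_, ?_⟩
  · intro v
    rw [e5, e4, eitems, h44]
    exact hV.load_eq v
  · rw [e12, e13, eitems]
    exact hL₄
  · rw [esrc, edst, eL, e9, e10, e11]
    exact hT
  · rw [esrc, edst, eL, e9]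
    exact hcl
  · rw [eL, e9]
    exact hlt
  · rw [e5', e9]
    exact hall
  · rw [e5', e9, eL]
    exact hfin

/-- Either one unit of load leaves `v₀` for a vertex below the rank, or the input is rejected. In
the latter case register 7 jumps to `n + n`, which ends the main loop. -/
theorem runs_augmentOrReject {G : Graph (Fin n) (Fin m)} (hG : ∀ e, G.IsLink e (fst e) (snd e))
    (hVG : V(G) = Set.univ) (hEG : E(G) = Set.univ) (hM : M.E = Set.univ)
    {s : State} {v₀ : ℕ} (hQ : 1 ≤ Q) (ht : 1 ≤ t)
    (hR : s.Ready fst snd root M) (hV : s.Valid M m) (hv : s.reg 8 = v₀) (hv₀ : v₀ < n)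
    (hload : s.arr 5 v₀ ≠ 0) :
    Runs (indepOracle M) Q (.seq search augmentOrReject) s (1000 * (t ^ 2 * Q + m + n)) fun s' =>
      (s'.Valid M m ∧ s'.reg 7 = s.reg 7 ∧ s'.reg 16 = s.reg 16 ∧
        ∃ w < n, w ≠ v₀ ∧ s.arr 5 w < rank M ∧
          ∀ v, s'.arr 5 v + (if v₀ = v then 1 else 0) = s.arr 5 v + (if w = v then 1 else 0)) ∨
      (¬ (C1 G root M ∧ C2 G root M) ∧ s'.reg 7 = n + n ∧ s'.reg 16 = 0) := by
  have hcost : (100 * (t + 1) ^ 2 * Q + 170 * m + 90 * t ^ 2 + 100 * n + 300) +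
      (3 + 1 + (50 * (n + 1))) ≤ 1000 * (t ^ 2 * Q + m + n) := by
    have h1 : (t + 1) ^ 2 * Q ≤ 4 * (t ^ 2 * Q) := by
      rw [← mul_assoc]
      exact Nat.mul_le_mul_right _ (by nlinarith)
    have h2 : t ^ 2 ≤ t ^ 2 * Q := Nat.le_mul_of_pos_right _ hQ
    have h3 : 1 ≤ t ^ 2 := Nat.one_le_pow _ _ ht
    rw [mul_assoc]
    omega
  refine Runs.mono (Runs.seq (runs_search hQ hR hV hv hv₀) ?_) hcost fun _ _ h => h
  rintro s' f ⟨hV', h5, hLn, ⟨N, hL, hT, hcl⟩, hlt, h0, hall, hfin⟩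
  have R' : s'.Ready fst snd root M := hR.frame f
    (by simp [search, rootArcs, rootArcsFrom, testPair, addArc, forLoop, edgeArcs, clearSearch,
      buildLists, searchLoop, searchStep, findTarget]; omega)
    (by simp [search, rootArcs, rootArcsFrom, testPair, addArc, forLoop, edgeArcs, clearSearch,
      buildLists, searchLoop, searchStep, findTarget])
  have e7 : s'.reg 7 = s.reg 7 := f.1 7 (by simp [search, rootArcs, rootArcsFrom, testPair, addArc,
    forLoop, edgeArcs, clearSearch, buildLists, searchLoop, searchStep, findTarget])
  have e16 : s'.reg 16 = s.reg 16 := f.1 16 (by simp [search, rootArcs, rootArcsFrom, testPair,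
    addArc, forLoop, edgeArcs, clearSearch, buildLists, searchLoop, searchStep, findTarget])
  refine Runs.ite (b := .lt (.reg 15) (.reg 12)) (fun hb => ?_) (fun hb => ?_)
  · have hb' : s'.reg 15 < s'.reg 12 := by
      by_contra h
      simp [h] at hb
    refine (runs_augment hV' hL hT hb').mono (by omega) ?_
    rintro s'' f' ⟨hV'', hq⟩
    refine Or.inl ⟨hV'', (f'.1 7 (by simp [augment, augmentStep])).trans e7,
      (f'.1 16 (by simp [augment, augmentStep])).trans e16, s'.arr 9 (s'.reg 15),
      hlt _ hb', ?_, ?_, ?_⟩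
    · intro h
      have := hT.inj _ hb' 0 hT.pos (h.trans hT.root.symm)
      omega
    · rw [← h5]
      exact (hfin.resolve_left (by omega)).2
    · rw [← h5]
      exact hq
  · have hb' : s'.reg 15 = s'.reg 12 := by
      refine hfin.resolve_right fun h => ?_
      simp [h.1] at hb
    refine Runs.straight (by simp) (by simp; omega) (Or.inr ⟨?_, ?_, ?_⟩)
    -- The exhausted search has reached a closed set in which every vertex but `v₀` carries at least
    -- the rank.
    · refine not_C1_and_C2_of_closed hG hVG hEG R'.loc hM hV'.base
        {v | ∃ b < s'.reg 12, s'.arr 9 b = v} ?_ v₀ hv₀ ⟨0, hT.pos, hT.root⟩ ?_ ?_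
      · rintro x y harc ⟨a, ha, hax⟩
        obtain ⟨j, hj, rfl, rfl⟩ := (hL x y).2 harc
        exact hcl a ha j hj hax.symm
      · rw [← hV'.load_eq, h5]
        exact hload
      · rintro v hvn ⟨b, hb, rfl⟩ hne
        rw [← hV'.load_eq]
        refine hall b (Nat.pos_of_ne_zero ?_) (by omega)
        rintro rfl
        exact hne hT.root
    · simp [R'.reg_zero]
    · simp

end OracleRAM

namespace OracleRAM

open RootedGraph

variable {n m t Q : ℕ} {M : Matroid (Fin t)} {fst snd : Fin m → Fin n} {root : Fin t → Fin n}

/-- The vertex that is treated in round `j` of the two passes over all vertices. -/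
def roundVertex (n j : ℕ) : ℕ := if j < n then j else j - n

/-- One step of the main loop: augment for the current vertex, or go on to the next round. -/
def mainStep : Prog := .seq
  (.ite (.lt (.reg 7) (.reg 0)) (.assign 8 (.reg 7)) (.assign 8 (.sub (.reg 7) (.reg 0))))
  (.ite (.get 5 (.reg 8)) (.seq search augmentOrReject)
    (.assign 7 (.add (.reg 7) (.const 1))))

/-- The main loop: two passes over all vertices. -/
def mainLoop : Prog := .while (.lt (.reg 7) (.add (.reg 0) (.reg 0))) mainStep

/-- A bound for the number of steps of the main loop that remain. -/
def remaining (n : ℕ) (w : ℕ → ℕ) (q : ℕ → ℕ) (j : ℕ) : ℕ :=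
  (n + n - j) + if j < n + n then
    q (roundVertex n j) + ∑ i ∈ Finset.Ico (j + 1) (n + n), w (roundVertex n i) else 0

theorem roundVertex_lt {n j : ℕ} (h : j < n + n) : roundVertex n j < n := by
  unfold roundVertex
  split_ifs <;> omega

/-- The next round starts with the actual load of its vertex, for which `w` had been reserved; the
finished round frees the one. -/
theorem remaining_succ {n : ℕ} {w q : ℕ → ℕ} {j : ℕ} (hj : j < n + n) (hw : ∀ v < n, q v ≤ w v) :
    remaining n w q (j + 1) + 1 ≤ remaining n w q j := by
  unfold remaining
  rw [if_pos hj]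
  split_ifs with h
  · rw [Finset.sum_eq_sum_Ico_succ_bot h]
    have := hw _ (roundVertex_lt h)
    omega
  · omega

theorem remaining_zero_le (n : ℕ) {w q : ℕ → ℕ} (hw : ∀ v < n, q v ≤ w v) :
    remaining n w q 0 ≤ n + n + (∑ v ∈ Finset.range n, w v + ∑ v ∈ Finset.range n, w v) := by
  have hsum : ∑ i ∈ Finset.range (n + n), w (roundVertex n i) =
      ∑ v ∈ Finset.range n, w v + ∑ v ∈ Finset.range n, w v := by
    rw [Finset.sum_range_add]
    congr 1
    · exact Finset.sum_congr rfl fun i hi => by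
        rw [roundVertex, if_pos (Finset.mem_range.1 hi)]
    · exact Finset.sum_congr rfl fun i _ => by
        rw [roundVertex, if_neg (by omega), Nat.add_sub_cancel_left]
  rw [← hsum, remaining]
  split_ifs with h
  · rw [Finset.range_eq_Ico, Finset.sum_eq_sum_Ico_succ_bot h]
    have := hw _ (roundVertex_lt h)
    omega
  · omega

/-- The invariant of the main loop, unless the input has been rejected. -/
structure MainInv (M : Matroid (Fin t)) (m n : ℕ) (loc w : ℕ → ℕ) (s : State) : Prop where
  valid : s.Valid M m
  load_le : ∀ v < n, s.arr 5 v ≤ w v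
  load_le_rank : ∀ v < n, v < s.reg 7 → s.arr 5 v ≤ rank M
  certified : ∀ v < n, v + n < s.reg 7 → ∃ B, (itemMatroid M m).IsBase B ∧
    load (t + m + m) loc B v = 0 ∧ ∀ u < n, load (t + m + m) loc B u ≤ rank M

/-- Only vertices below the rank gain load, and by one, so a load that is at most the rank remains
so. Each vertex ends its round of the first pass at load 0 and is bounded from then on. -/
theorem runs_mainStep {G : Graph (Fin n) (Fin m)} (hG : ∀ e, G.IsLink e (fst e) (snd e))
    (hVG : V(G) = Set.univ) (hEG : E(G) = Set.univ) (hM : M.E = Set.univ)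
    {s : State} {loc w : ℕ → ℕ} (hQ : 1 ≤ Q) (ht : 1 ≤ t) (hw : ∀ v, rank M ≤ w v)
    (hR : s.Ready fst snd root M) (hloc : s.arr 4 = loc) (hI : MainInv M m n loc w s)
    (h7 : s.reg 7 < n + n) :
    Runs (indepOracle M) Q mainStep s (1000 * (t ^ 2 * Q + m + n) + 20) fun s' =>
      (MainInv M m n loc w s' ∧ s'.reg 7 ≤ n + n ∧ s'.reg 16 = s.reg 16 ∧
        remaining n w (s'.arr 5) (s'.reg 7) + 1 ≤ remaining n w (s.arr 5) (s.reg 7)) ∨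
      (¬ (C1 G root M ∧ C2 G root M) ∧ s'.reg 7 = n + n ∧ s'.reg 16 = 0) := by
  refine Runs.mono (T := 10 + (2 + 1 + (1000 * (t ^ 2 * Q + m + n) + 4)))
    (Runs.seq (mid := fun s' => s' = s.setReg 8 (roundVertex n (s.reg 7))) ?_ ?_) (by omega)
    fun _ _ h => h
  · refine Runs.straight (by simp) (by simp) ?_
    by_cases h : s.reg 7 < n <;> simp [h, hR.reg_zero, roundVertex]
  rintro s' f rfl
  have R' := hR.frame f (by simp; omega) (by simp)
  have hvn := roundVertex_lt h7
  refine Runs.ite (b := .get 5 (.reg 8)) (fun hb => ?_) (fun hb => ?_)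
  · have hV' : (s.setReg 8 (roundVertex n (s.reg 7))).Valid M m :=
      ⟨hI.valid.base, hI.valid.le_one, hI.valid.load_eq⟩
    refine (runs_augmentOrReject hG hVG hEG hM hQ ht R' hV' (v₀ := roundVertex n (s.reg 7))
      (by simp) hvn (by simpa using hb)).mono (by omega) ?_
    rintro s'' - (⟨hV, e7, e16, u, hun, huv, hlt, hq⟩ | h)
    · left
      simp only [State.setReg_reg, Nat.reduceEqDiff, if_false, State.setReg_arr] at e7 e16 hlt hq
      have hother : ∀ v, v ≠ u → s''.arr 5 v ≤ s.arr 5 v := by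
        intro v hv
        have := hq v
        rw [if_neg (Ne.symm hv)] at this
        omega
      have hu : s''.arr 5 u ≤ rank M := by
        have := hq u
        rw [if_pos rfl, if_neg huv.symm] at this
        omega
      refine ⟨⟨hV, ?_, ?_, ?_⟩, by omega, e16, ?_⟩
      · intro v hv
        by_cases h : v = u
        · exact h ▸ hu.trans (hw u)
        · exact (hother v h).trans (hI.load_le v hv)
      · intro v hv hv7
        by_cases h : v = u
        · exact h ▸ hu
        · exact (hother v h).trans (hI.load_le_rank v hv (by omega))
      · rw [e7]
        exact hI.certified
      · have := hq (roundVertex n (s.reg 7))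
        rw [if_pos rfl, if_neg huv] at this
        rw [remaining, remaining, e7, if_pos h7, if_pos h7]
        omega
    · exact Or.inr h
  · refine Runs.straight (by simp) (by simp) (Or.inl ?_)
    have h0 : s.arr 5 (roundVertex n (s.reg 7)) = 0 := by simpa using hb
    have hle : ∀ v < n, v < s.reg 7 + 1 → s.arr 5 v ≤ rank M := by
      intro v hv hv7
      by_cases h : v = roundVertex n (s.reg 7)
      · rw [h, h0]
        exact Nat.zero_le _
      · refine hI.load_le_rank v hv ?_
        unfold roundVertex at h
        split_ifs at h <;> omega
    refine ⟨⟨⟨hI.valid.base, hI.valid.le_one, hI.valid.load_eq⟩, hI.load_le, ?_, ?_⟩, ?_, ?_, ?_⟩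
    · simpa using hle
    · simp only [Prog.run, Expr.eval, State.setReg_reg, Nat.reduceEqDiff, if_true, if_false]
      intro v hv hv7
      by_cases h : v + n = s.reg 7
      -- In the second pass every vertex has already been treated, so all loads are bounded and the
      -- current base certifies `v`.
      · refine ⟨s.items, hI.valid.base, ?_, fun u hu => ?_⟩
        · have : roundVertex n (s.reg 7) = v := by
            unfold roundVertex
            rw [if_neg (by omega)]
            omega
          rw [← hloc, ← hI.valid.load_eq, ← this, h0]
        · rw [← hloc, ← hI.valid.load_eq]
          exact hle u hu (by omega)
      · exact hI.certified v hv (by omega)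
    · simp only [Prog.run, Expr.eval, State.setReg_reg, Nat.reduceEqDiff, if_true, if_false]
      omega
    · simp
    · simpa using remaining_succ h7 hI.load_le

theorem sum_load_range_le (g : ℕ) (loc : ℕ → ℕ) (B : Set ℕ) (n : ℕ) :
    ∑ v ∈ Finset.range n, load g loc B v ≤ g := by
  classical
  simp only [load]
  rw [Finset.sum_comm]
  refine (Finset.sum_le_card_nsmul _ _ 1 fun i _ => ?_).trans (by simp)
  by_cases h : i ∈ B
  · simp [h]
  · simp only [h, not_false_eq_true, true_and, Finset.sum_ite_eq]
    split_ifs <;> omega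

/-- A vertex gains only below the rank, so its load never exceeds the rank plus its initial load,
which is `w`. Each round needs at most that many augmentations, and the initial loads sum to at most
the number `t + m + m` of items. -/
theorem runs_mainLoop {G : Graph (Fin n) (Fin m)} (hG : ∀ e, G.IsLink e (fst e) (snd e))
    (hVG : V(G) = Set.univ) (hEG : E(G) = Set.univ) (hM : M.E = Set.univ)
    {s : State} (hQ : 1 ≤ Q) (ht : 1 ≤ t) (hR : s.Ready fst snd root M) (hV : s.Valid M m)
    (h7 : s.reg 7 = 0) (h16 : s.reg 16 = 1) :
    Runs (indepOracle M) Q mainLoop s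
      ((1000 * (t ^ 2 * Q + m + n) + 40) * (2 * n + 2 * (n * rank M + (t + m + m))) + 10) fun s' =>
      (C1 G root M ∧ C2 G root M ∧ s'.reg 16 = 1) ∨
      (¬ (C1 G root M ∧ C2 G root M) ∧ s'.reg 16 = 0) := by
  set S := 1000 * (t ^ 2 * Q + m + n) + 40 with hS
  obtain ⟨w, hw⟩ : ∃ w : ℕ → ℕ, ∀ v, w v = rank M + s.arr 5 v := ⟨_, fun _ => rfl⟩
  have hwle : ∀ v < n, s.arr 5 v ≤ w v := fun v _ => by
    rw [hw]
    exact Nat.le_add_left _ _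
  have hrem : remaining n w (s.arr 5) 0 ≤ 2 * n + 2 * (n * rank M + (t + m + m)) := by
    refine (remaining_zero_le n hwle).trans ?_
    have : ∑ v ∈ Finset.range n, w v ≤ n * rank M + (t + m + m) := by
      simp only [hw]
      rw [Finset.sum_add_distrib, Finset.sum_const, Finset.card_range, smul_eq_mul]
      refine Nat.add_le_add_left ?_ _
      simp only [hV.load_eq]
      exact sum_load_range_le _ _ _ _
    omega
  have hcost : S * remaining n w (s.arr 5) 0 + 5 + 1 ≤
      S * (2 * n + 2 * (n * rank M + (t + m + m))) + 10 := by
    have := Nat.mul_le_mul_left S hrem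
    omega
  refine Runs.mono (Runs.while (I := fun c s' => s'.reg 7 ≤ n + n ∧
    ((MainInv M m n (s.arr 4) w s' ∧ s'.reg 16 = 1 ∧ c = S * remaining n w (s'.arr 5) (s'.reg 7)) ∨
      (¬ (C1 G root M ∧ C2 G root M) ∧ s'.reg 7 = n + n ∧ s'.reg 16 = 0)))
    (S * remaining n w (s.arr 5) 0) _ ?_ ?_) hcost ?_
  · refine ⟨by omega, Or.inl ⟨⟨hV, hwle, by omega, by omega⟩, h16, by rw [h7]⟩⟩
  · rintro c s' ⟨hle, h⟩ f hb
    have hR' : s'.Ready fst snd root M := hR.frame f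
      (by simp [mainStep, search, augmentOrReject, augment, augmentStep, rootArcs, rootArcsFrom,
        testPair, addArc, forLoop, edgeArcs, clearSearch, buildLists, searchLoop, searchStep,
        findTarget]; omega)
      (by simp [mainStep, search, augmentOrReject, augment, augmentStep, rootArcs, rootArcsFrom,
        testPair, addArc, forLoop, edgeArcs, clearSearch, buildLists, searchLoop, searchStep,
        findTarget])
    have h4 : s'.arr 4 = s.arr 4 := f.2 4 (by
      simp [mainStep, search, augmentOrReject, augment, augmentStep, rootArcs, rootArcsFrom,
        testPair, addArc, forLoop, edgeArcs, clearSearch, buildLists, searchLoop, searchStep,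
        findTarget])
    have hlt : s'.reg 7 < n + n := by
      by_contra h
      simp [hR'.reg_zero, h] at hb
    obtain ⟨hI, h16', rfl⟩ := h.resolve_right (by omega)
    refine ⟨1000 * (t ^ 2 * Q + m + n) + 20, (runs_mainStep hG hVG hEG hM hQ ht
      (fun v => hw v ▸ Nat.le_add_right _ _) hR' h4 hI hlt).mono le_rfl ?_⟩
    rintro s'' - (⟨hI', hle', e16, hrem'⟩ | ⟨hno, e7, e16⟩)
    · refine ⟨S * remaining n w (s''.arr 5) (s''.reg 7), ⟨hle', Or.inl ⟨hI', by omega, rfl⟩⟩, ?_⟩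
      have := Nat.mul_le_mul_left S hrem'
      rw [Nat.mul_add, Nat.mul_one] at this
      simp only [Expr.cost]
      omega
    -- After a rejection the loop test fails at once, so no budget is kept.
    · refine ⟨0, ⟨by omega, Or.inr ⟨hno, e7, e16⟩⟩, ?_⟩
      have hpos : 1 ≤ remaining n w (s'.arr 5) (s'.reg 7) := by
        unfold remaining
        omega
      have := Nat.mul_le_mul_left S hpos
      simp only [Expr.cost]
      omega
  · rintro s' f ⟨⟨c, hle, h⟩, hb⟩
    rcases h with ⟨hI, e16, -⟩ | ⟨hno, e7, e16⟩
    · left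
      have h0 : s'.reg 0 = n := (f.1 0 (by
        simp [mainLoop, mainStep, search, augmentOrReject, augment, augmentStep, rootArcs, rootArcsFrom,
          testPair, addArc, forLoop, edgeArcs, clearSearch, buildLists, searchLoop, searchStep,
          findTarget])).trans hR.reg_zero
      have hge : n + n ≤ s'.reg 7 := by
        by_contra h
        have h' : s'.reg 7 < n + n := by omega
        simp [h0, h'] at hb
      have := C1_and_C2_of_isBase (M := M) (root := root) hG hR.loc
        fun v hv => hI.certified v hv (by omega)
      exact ⟨this.1, this.2, e16⟩
    · exact Or.inr ⟨hno, e16⟩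

/-! ### The program -/

/-- Stores the product of registers `0` and `3` in register `6`. -/
def computeProduct : Prog := .seq (.assign 6 (.const 0)) <|
  forLoop 4 (.reg 3) (.assign 6 (.add (.reg 6) (.reg 0)))

/-- The machine does not multiply, but `k` additions are cheap enough. -/
theorem runs_computeProduct {O : (ℕ → ℕ) → Prop} {s : State} {k : ℕ} (hn : s.reg 0 = n)
    (hk : s.reg 3 = k) :
    Runs O Q computeProduct s (20 * (k + 1)) fun s' => s'.reg 6 = k * n := by
  refine Runs.mono (T := 2 + (k * (4 + 1 + 7) + 1 + 5)) (Runs.seq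
    (mid := fun s' => s' = s.setReg 6 0) ⟨_, _, Exec.assign _ _ _, le_rfl, rfl⟩ ?_) (by omega)
    fun _ _ h => h
  rintro _ - rfl
  refine Runs.mono (Runs.forLoop k 4 (fun j s' => s'.reg 6 = j * n) ?_ ?_ ?_ ?_) le_rfl ?_
  · simp
  · intro s' hf
    simpa [hk] using hf.1 3 (by simp [forLoop])
  · simp
  · intro j s' hj hI hj' hf
    refine Runs.straight (by simp) (by simp) ?_
    have h0 : s'.reg 0 = n := (hf.1 0 (by simp [forLoop])).trans (by simpa using hn)
    simp [hI, h0, Nat.add_mul]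
  · rintro s' - ⟨h, -⟩
    exact h

/-- Decides (C1) and (C2), given a base, the rank and (C3). -/
def decideCounts : Prog := .seq rootPositions <| .seq edgePositions <| .seq computeLoads <|
  .seq (.assign 7 (.const 0)) <| .seq (.assign 16 (.const 1)) <| .seq mainLoop <|
  .assign 0 (.reg 16)

/-- Decides the conditions if the root `0` is not a loop. -/
def decideNonloop : Prog := .seq greedy <| .seq computeProduct <|
  .ite (.eq (.add (.reg 1) (.reg 2)) (.reg 6)) decideCounts (.assign 0 (.const 0))

/-- The program that decides the three conditions. -/
def decider : Prog := .ite (.reg 2)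
  (.seq (.store 3 (.const 0) (.const 1)) <| .seq (.query 5 3) <|
    .seq (.store 3 (.const 0) (.const 0)) <| .ite (.reg 5) decideNonloop (.assign 0 (.const 0)))
  (.assign 0 (.eq (.reg 1) (.const 0)))

theorem runs_decideCounts {G : Graph (Fin n) (Fin m)} (hG : ∀ e, G.IsLink e (fst e) (snd e))
    (hVG : V(G) = Set.univ) (hEG : E(G) = Set.univ) (hM : M.E = Set.univ)
    {s : State} (hQ : 1 ≤ Q) (ht : 1 ≤ t) (h0 : s.reg 0 = n) (h1 : s.reg 1 = m) (h2 : s.reg 2 = t)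
    (h3 : s.reg 3 = rank M) (a0 : s.arr 0 = arrayOf fst) (a1 : s.arr 1 = arrayOf snd)
    (a2 : s.arr 2 = arrayOf root) (hB : M.IsBase {i : Fin t | s.arr 3 i ≠ 0})
    (hle : ∀ i, s.arr 3 i ≤ 1) (hz : ∀ i, t ≤ i → s.arr 3 i = 0) (a5 : ∀ v, s.arr 5 v = 0) :
    Runs (indepOracle M) Q decideCounts s
      (20 * (t + 1) + 50 * (m + 1) + 60 * (t + m + m + 1) + 20 +
        (1000 * (t ^ 2 * Q + m + n) + 40) * (2 * n + 2 * (n * rank M + (t + m + m)))) fun s' =>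
      (C1 G root M ∧ C2 G root M ∧ s'.reg 0 = 1) ∨
      (¬ (C1 G root M ∧ C2 G root M) ∧ s'.reg 0 = 0) := by
  refine Runs.mono (T := 20 * (t + 1) + (50 * (m + 1) + (60 * (t + m + m + 1) + (2 + (2 + (
    ((1000 * (t ^ 2 * Q + m + n) + 40) * (2 * n + 2 * (n * rank M + (t + m + m))) + 10) + 2))))))
    ?_ (by omega) fun _ _ h => h
  refine Runs.seq (runs_rootPositions h2 a2) ?_
  intro s₁ f₁ hp₁
  have g₁ : ∀ x ≠ 4, s₁.reg x = s.reg x := fun x hx => f₁.1 x (by simpa [rootPositions, forLoop])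
  have b₁ : ∀ a ≠ 4, s₁.arr a = s.arr a := fun a ha => f₁.2 a (by simpa [rootPositions, forLoop])
  refine Runs.seq (runs_edgePositions (fst := fst) (snd := snd) ((g₁ 1 (by simp)).trans h1)
    ((g₁ 2 (by simp)).trans h2) ((b₁ 0 (by simp)).trans a0) ((b₁ 1 (by simp)).trans a1)) ?_
  rintro s₂ f₂ ⟨hp₂, hf₂, hs₂, hi₂⟩
  have g₂ : ∀ x ≠ 4, s₂.reg x = s.reg x := fun x hx =>
    (f₂.1 x (by simpa [edgePositions, forLoop])).trans (g₁ x hx)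
  have a5' : ∀ v, s₂.arr 5 v = 0 := by
    rw [f₂.2 5 (by simp [edgePositions, forLoop]), b₁ 5 (by simp)]
    exact a5
  rw [b₁ 3 (by simp)] at hi₂
  -- The starting base is the greedy base with the first half of every edge.
  have hbase : (itemMatroid M m).IsBase s₂.items := by
    refine itemMatroid_isBase_iff.2 ⟨?_, ?_, ?_⟩
    · convert hB using 1
      ext i
      have := i.2
      simp only [State.items, hi₂, Set.mem_ofPred_eq]
      rw [if_neg (by omega)]
    · intro e he
      simp only [State.items, hi₂, Set.mem_ofPred_eq]
      rw [if_neg (by omega), if_pos (by omega), hz _ (by omega)]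
      simp
    · intro i hi
      by_contra hge
      refine hi ?_
      rw [hi₂, if_neg (by omega), hz _ (by omega)]
  have hloc : IsLoc fst snd root (s₂.arr 4) :=
    ⟨fun i => (hp₂ i i.2).trans (hp₁ i), hf₂, hs₂⟩
  refine Runs.seq (runs_computeLoads ((g₂ 1 (by simp)).trans h1) ((g₂ 2 (by simp)).trans h2) a5') ?_
  intro s₃ f₃ hl₃
  have g₃ : ∀ x ≠ 4, s₃.reg x = s.reg x := fun x hx =>
    (f₃.1 x (by simpa [computeLoads, forLoop])).trans (g₂ x hx)
  have e3 : s₃.arr 3 = s₂.arr 3 := f₃.2 3 (by simp [computeLoads, forLoop])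
  have e4 : s₃.arr 4 = s₂.arr 4 := f₃.2 4 (by simp [computeLoads, forLoop])
  refine Runs.seq ⟨_, _, Exec.assign _ _ _, by simp, rfl⟩ ?_
  rintro _ - rfl
  refine Runs.seq ⟨_, _, Exec.assign _ _ _, by simp, rfl⟩ ?_
  rintro _ - rfl
  refine Runs.seq (runs_mainLoop hG hVG hEG hM hQ ht (fst := fst) (snd := snd) (root := root)
    ⟨?_, ?_, ?_, ?_, ?_⟩ ⟨?_, ?_, ?_⟩ ?_ ?_) ?_
  · simp [g₃, h0]
  · simp [g₃, h1]
  · simp [g₃, h2]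
  · simp [g₃, h3]
  · simpa [e4] using hloc
  · simpa [State.items, e3] using hbase
  · intro i
    simp only [State.setReg_arr, e3, hi₂]
    split_ifs
    · exact le_rfl
    · exact hle i
  · intro v
    simpa [State.items, e3, e4] using hl₃ v
  · simp
  · simp
  · rintro s₄ - h
    exact Runs.straight (by simp) (by simp) (by simpa using h)

/-- By (C3), `m + t` becomes `a = k * n`: at most `8 * a` steps of time at most `1000 * (t ^ 2 * Q)
+ 2040 * a` each. The further factors `k` in the bound are slack. -/
theorem decideCounts_time_le {k n m t Q : ℕ} (hk : 1 ≤ k) (hn : 1 ≤ n) (ht : 1 ≤ t)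
    (h : m + t = k * n) :
    20 * (t + 1) + 50 * (m + 1) + 60 * (t + m + m + 1) + 20 +
        (1000 * (t ^ 2 * Q + m + n) + 40) * (2 * n + 2 * (n * k + (t + m + m))) ≤
      17000 * (k ^ 4 * n ^ 2 + k ^ 2 * n * t ^ 2 * Q) := by
  obtain ⟨a, ha⟩ : ∃ a, a = k * n := ⟨_, rfl⟩
  have ha1 : 1 ≤ a := ha ▸ Nat.mul_pos hk hn
  have hna : n ≤ a := ha ▸ Nat.le_mul_of_pos_left n hk
  have hnk : n * k = a := by rw [ha, mul_comm]
  have h1 : a * a ≤ k ^ 4 * n ^ 2 := by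
    rw [ha, show k ^ 4 * n ^ 2 = k * n * (k * n) * k ^ 2 by ring]
    exact Nat.le_mul_of_pos_right _ (Nat.pow_pos hk)
  have h2 : a * (t ^ 2 * Q) ≤ k ^ 2 * n * t ^ 2 * Q := by
    rw [ha, show k ^ 2 * n * t ^ 2 * Q = k * n * (t ^ 2 * Q) * k by ring]
    exact Nat.le_mul_of_pos_right _ hk
  have h3 : a ≤ a * a := Nat.le_mul_of_pos_right _ ha1
  have h4 : (1000 * (t ^ 2 * Q + m + n) + 40) * (2 * n + 2 * (n * k + (t + m + m))) ≤
      (1000 * (t ^ 2 * Q) + 2040 * a) * (8 * a) := Nat.mul_le_mul (by omega) (by omega)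
  have h5 : (1000 * (t ^ 2 * Q) + 2040 * a) * (8 * a) =
      8000 * (a * (t ^ 2 * Q)) + 16320 * (a * a) := by ring
  omega

/-- Without roots the rank is 0, so (C3) forbids edges, and then nothing is left to check in (C1)
and (C2). -/
theorem conditions_iff_of_zero {n m : ℕ} {G : Graph (Fin n) (Fin m)} {root : Fin 0 → Fin n}
    (hEG : E(G) = Set.univ) (M : Matroid (Fin 0)) :
    rank M = 0 ∧ (Conditions G root M ↔ m = 0) := by
  have hrank : rank M = 0 := by
    obtain ⟨B, hB⟩ := M.exists_isBase
    rw [rank, ← hB.encard_eq_eRank, Set.eq_empty_of_isEmpty B]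
    simp
  refine ⟨hrank, fun h => ?_, ?_⟩
  · have h3 := h.2.2
    rw [C3, hrank, hEG, Set.ncard_univ] at h3
    simpa using h3
  · rintro rfl
    refine ⟨fun v _ => ?_, fun F _ hF => ?_, ?_⟩
    · rw [Set.eq_empty_of_isEmpty (rootsIn root {v})]
      exact M.empty_indep
    · obtain ⟨e, -⟩ := hF
      exact e.elim0
    · rw [C3, hrank, hEG, Set.ncard_univ]
      simp

theorem one_le_rank_of_indep (M : Matroid (Fin t)) {r : Fin t} (h : M.Indep {r}) : 1 ≤ rank M := by
  obtain ⟨B, hB, hrB⟩ := h.exists_isBase_superset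
  rw [rank, ← hB.encard_eq_eRank]
  exact (Set.ncard_pos).2 ⟨r, hrB rfl⟩

/-- Since `k`, `n` and `t` are positive, the greedy phase and the product fit into the bound. (C3)
is tested before the main loop because the time bound for that loop relies on it. -/
theorem runs_decideNonloop {G : Graph (Fin n) (Fin m)} (hG : ∀ e, G.IsLink e (fst e) (snd e))
    (hVG : V(G) = Set.univ) (hEG : E(G) = Set.univ) (hM : M.E = Set.univ) (hQ : 1 ≤ Q)
    (ht : 1 ≤ t) (hn : 1 ≤ n) (hk : 1 ≤ rank M) {s : State} (h0 : s.reg 0 = n) (h1 : s.reg 1 = m)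
    (h2 : s.reg 2 = t) (a0 : s.arr 0 = arrayOf fst) (a1 : s.arr 1 = arrayOf snd)
    (a2 : s.arr 2 = arrayOf root) (a3 : ∀ i, s.arr 3 i = 0) (a5 : ∀ v, s.arr 5 v = 0) :
    Runs (indepOracle M) Q decideNonloop s
      (20000 * (rank M ^ 4 * n ^ 2 + rank M ^ 2 * n * t ^ 2 * Q)) fun s' =>
      (Conditions G root M ∧ s'.reg 0 = 1) ∨ (¬ Conditions G root M ∧ s'.reg 0 = 0) := by
  set U := rank M ^ 4 * n ^ 2 + rank M ^ 2 * n * t ^ 2 * Q with hU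
  have hC3 : C3 G M ↔ m + t = rank M * n := by
    rw [C3, hEG, hVG, Set.ncard_univ, Set.ncard_univ, Nat.card_fin, Nat.card_fin, Nat.card_fin]
  have htQ : t * Q ≤ U := by
    refine le_trans ?_ (Nat.le_add_left _ _)
    rw [show rank M ^ 2 * n * t ^ 2 * Q = t * Q * (rank M ^ 2 * n * t) by ring]
    exact Nat.le_mul_of_pos_right _ (by positivity)
  have hkU : rank M ≤ U := by
    refine le_trans ?_ (Nat.le_add_left _ _)
    rw [show rank M ^ 2 * n * t ^ 2 * Q = rank M * (rank M * n * t ^ 2 * Q) by ring]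
    exact Nat.le_mul_of_pos_right _ (by positivity)
  have hgr : 30 * (t + 1) * Q ≤ 60 * U := by
    refine le_trans ?_ (Nat.mul_le_mul_left 60 htQ)
    rw [← mul_assoc]
    exact Nat.mul_le_mul_right _ (by omega)
  refine Runs.mono (T := 60 * U + (40 * U + (5 + 1 + (17000 * U + 2)))) ?_ (by omega)
    fun _ _ h => h
  refine Runs.seq ((runs_greedy hM hQ h2 a3).mono hgr fun _ _ h => h) ?_
  rintro s₁ f₁ ⟨hB, hle, hz, h3⟩
  have g₁ : ∀ x, x ≠ 3 ∧ x ≠ 4 ∧ x ≠ 5 → s₁.reg x = s.reg x := fun x hx =>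
    f₁.1 x (by simp [greedy, greedyStep, forLoop, hx])
  have b₁ : ∀ a, a ≠ 3 → s₁.arr a = s.arr a := fun a ha =>
    f₁.2 a (by simp [greedy, greedyStep, forLoop, ha])
  refine Runs.seq ((runs_computeProduct (n := n) ((g₁ 0 (by simp)).trans h0) h3).mono (by omega)
    fun _ _ h => h) ?_
  intro s₂ f₂ h6
  have g₂ : ∀ x, x ≠ 4 ∧ x ≠ 6 → s₂.reg x = s₁.reg x := fun x hx =>
    f₂.1 x (by simp [computeProduct, forLoop, hx])
  have b₂ : s₂.arr = s₁.arr := by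
    funext a
    exact f₂.2 a (by simp [computeProduct, forLoop])
  have k0 : s₂.reg 0 = n := (g₂ 0 (by simp)).trans ((g₁ 0 (by simp)).trans h0)
  have k1 : s₂.reg 1 = m := (g₂ 1 (by simp)).trans ((g₁ 1 (by simp)).trans h1)
  have k2 : s₂.reg 2 = t := (g₂ 2 (by simp)).trans ((g₁ 2 (by simp)).trans h2)
  have k3 : s₂.reg 3 = rank M := (g₂ 3 (by simp)).trans h3
  refine Runs.ite (b := .eq (.add (.reg 1) (.reg 2)) (.reg 6)) (fun hb => ?_) (fun hb => ?_)
  · have hc : m + t = rank M * n := by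
      by_contra h
      simp [k1, k2, h6, h] at hb
    refine (runs_decideCounts hG hVG hEG hM hQ ht k0 k1 k2 k3 (root := root) ?_ ?_ ?_ ?_ ?_ ?_
      ?_).mono ((decideCounts_time_le hk hn ht hc).trans (by omega)) ?_
    · rw [b₂, b₁ 0 (by simp), a0]
    · rw [b₂, b₁ 1 (by simp), a1]
    · rw [b₂, b₁ 2 (by simp), a2]
    · rw [b₂]
      exact hB
    · rw [b₂]
      exact hle
    · rw [b₂]
      exact hz
    · rw [b₂, b₁ 5 (by simp)]
      exact a5
    · rintro s' - (⟨hc1, hc2, h⟩ | ⟨hno, h⟩)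
      · exact Or.inl ⟨⟨hc1, hc2, hC3.2 hc⟩, h⟩
      · exact Or.inr ⟨fun h => hno ⟨h.1, h.2.1⟩, h⟩
  · refine Runs.straight (by simp) (by simp) (Or.inr ⟨fun h => ?_, by simp⟩)
    simp [k1, k2, h6, hC3.1 h.2.2] at hb

/-- If root `0` is a loop, (C1) fails. In rank 0 every root is a loop, so a single query settles
that case in time `O(Q)`; if root `0` is not a loop, the rank is positive and the main bound
applies. -/
theorem runs_decider {G : Graph (Fin n) (Fin m)} (hG : ∀ e, G.IsLink e (fst e) (snd e))
    (hVG : V(G) = Set.univ) (hEG : E(G) = Set.univ) (hM : M.E = Set.univ) (hQ : 1 ≤ Q) :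
    Runs (indepOracle M) Q decider (input fst snd root)
      (if rank M = 0 then 30 * Q else
        20100 * (rank M ^ 4 * n ^ 2 + rank M ^ 2 * n * t ^ 2 * Q)) fun s =>
      (Conditions G root M ∧ s.reg 0 = 1) ∨ (¬ Conditions G root M ∧ s.reg 0 = 0) := by
  classical
  rcases Nat.eq_zero_or_pos t with rfl | ht
  · obtain ⟨hrank, hiff⟩ := conditions_iff_of_zero (root := root) hEG M
    rw [if_pos hrank]
    refine Runs.mono (T := 1 + 1 + 4) (Runs.ite (b := .reg 2) (fun hb => ?_) (fun _ => ?_))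
      (by omega) fun _ _ h => h
    · simp [input] at hb
    · refine Runs.straight (by simp) (by simp) ?_
      rw [hiff]
      by_cases h : m = 0 <;> simp [input, h]
  · have hn : 1 ≤ n := Nat.lt_of_le_of_lt (Nat.zero_le _) (root ⟨0, ht⟩).2
    have hset : {i : Fin t | Function.update (fun _ => 0) 0 1 (i : ℕ) ≠ 0} = {⟨0, ht⟩} := by
      ext i
      by_cases h : (i : ℕ) = 0 <;> simp [Fin.ext_iff, h]
    have hO : indepOracle M (Function.update (fun _ => 0) 0 1) ↔ M.Indep {⟨0, ht⟩} := by
      rw [indepOracle, hset]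
    have hback : Function.update (Function.update (fun _ : ℕ => 0) 0 1) 0 0 = fun _ => 0 := by
      funext i
      by_cases h : i = 0 <;> simp [h]
    set U := rank M ^ 4 * n ^ 2 + rank M ^ 2 * n * t ^ 2 * Q with hU
    have hpre : ∀ {T : ℕ}, (M.Indep {⟨0, ht⟩} → Runs (indepOracle M) Q decideNonloop
        (((((input fst snd root).setArr 3 0 1).setReg 5 1).setArr 3 0 0)) T fun s =>
          (Conditions G root M ∧ s.reg 0 = 1) ∨ (¬ Conditions G root M ∧ s.reg 0 = 0)) →
        Runs (indepOracle M) Q decider (input fst snd root) (12 + Q + T) fun s =>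
          (Conditions G root M ∧ s.reg 0 = 1) ∨ (¬ Conditions G root M ∧ s.reg 0 = 0) := by
      intro T hT
      refine Runs.mono (T := 1 + 1 + (3 + (Q + (3 + (1 + 1 + (T + 2))))))
        (Runs.ite (b := .reg 2) (fun _ => ?_) (fun hb => ?_)) (by omega) fun _ _ h => h
      · refine Runs.seq ⟨_, _, Exec.store _ _ _ _, by simp, rfl⟩ ?_
        rintro _ - rfl
        refine Runs.seq ⟨_, _, Exec.query _ _ _, le_rfl, rfl⟩ ?_
        rintro _ - rfl
        refine Runs.seq ⟨_, _, Exec.store _ _ _ _, by simp, rfl⟩ ?_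
        rintro _ - rfl
        have harr : ((input fst snd root).setArr 3 0 1).arr 3 =
          Function.update (fun _ => 0) 0 1 := by simp [input]
        simp only [Expr.eval, harr, hO]
        by_cases hi : M.Indep {⟨0, ht⟩}
        · simp only [hi, if_true]
          refine Runs.ite (b := .reg 5) (fun _ => (hT hi).mono (by omega) fun _ _ h => h)
            (fun hb => ?_)
          simp at hb
        · simp only [hi, if_false]
          refine Runs.ite (b := .reg 5) (fun hb => ?_) (fun _ => ?_)
          · simp at hb
          · refine Runs.straight (by simp) (by simp) (Or.inr ⟨fun h => hi ?_, by simp⟩)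
            refine (h.1 (root ⟨0, ht⟩) (by rw [hVG]; trivial)).subset ?_
            rintro _ rfl
            rfl
      · simp [input] at hb
        omega
    split_ifs with hk
    -- In rank 0 the branch for a nonloop is impossible, so time 0 may be claimed for it.
    · refine (hpre (T := 0) fun hi => ?_).mono (by omega) fun _ _ h => h
      have := one_le_rank_of_indep M hi
      omega
    · have hk' : 1 ≤ rank M := Nat.one_le_iff_ne_zero.2 hk
      have hQU : Q ≤ U := by
        refine le_trans ?_ (Nat.le_add_left _ _)
        exact Nat.le_mul_of_pos_left _ (by positivity)
      refine (hpre fun _ => runs_decideNonloop hG hVG hEG hM hQ ht hn hk' ?_ ?_ ?_ ?_ ?_ ?_ ?_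
        ?_).mono (by omega) fun _ _ h => h
      · simp [input]
      · simp [input]
      · simp [input]
      · simp [input]
      · simp [input]
      · simp [input]
      · intro i
        by_cases h : i = 0 <;> simp [input, h]
      · simp [input]

end OracleRAM

end

/-- One fixed program decides, for every graph with roots and every matroid on the roots, whether
the three conditions hold (register `0` ends with `1` for yes and `0` for no), within the stated
time. A matroid of rank `0`, where the main bound vanishes, takes a bounded number of operations
and oracle calls. -/
theorem mainTheorem4 :
    ∃ (P : OracleRAM.Prog) (C : ℕ),
      ∀ (n m t : ℕ) (G : Graph (Fin n) (Fin m)) (fst snd : Fin m → Fin n)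
        (root : Fin t → Fin n) (M : Matroid (Fin t)) (Q : ℕ),
        G.vertexSet = Set.univ → G.edgeSet = Set.univ → (∀ e, G.IsLink e (fst e) (snd e)) →
        M.E = Set.univ → 1 ≤ Q →
        ∃ (s : OracleRAM.State) (T : ℕ),
          OracleRAM.Exec (OracleRAM.indepOracle M) Q P (OracleRAM.input fst snd root) s T ∧
          (RootedGraph.Conditions G root M → s.reg 0 = 1) ∧
          (¬ RootedGraph.Conditions G root M → s.reg 0 = 0) ∧
          (1 ≤ RootedGraph.rank M →
            T ≤ C * (RootedGraph.rank M ^ 4 * n ^ 2 + RootedGraph.rank M ^ 2 * n * t ^ 2 * Q)) ∧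
          (RootedGraph.rank M = 0 → T ≤ C * Q) := by
  refine ⟨OracleRAM.decider, 20100, ?_⟩
  intro n m t G fst snd root M Q hVG hEG hG hM hQ
  obtain ⟨s, T, he, hT, hs⟩ := OracleRAM.runs_decider (root := root) hG hVG hEG hM hQ
  refine ⟨s, T, he, fun h => ?_, fun h => ?_, fun hk => ?_, fun hk => ?_⟩
  · exact (hs.resolve_right fun h' => h'.1 h).2
  · exact (hs.resolve_left fun h' => h h'.1).2
  · rwa [if_neg (by omega)] at hT
  · rw [if_pos hk] at hT
    omega
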